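/- Let $N\in\mathbb N$, $s\in(0,1)$, let $\Omega\subset\mathbb R^N$ be a bounded open set, and let $p:\mathbb R^N\times\mathbb R^N\to(1,\infty)$ be continuous and bounded with $$p^-:=\inf_{\mathbb R^N\times\mathbb R^N}p>1,\qquad p(x,y)=p(y,x)\ \text{ for all } x,y\in\overline\Omega,\qquad s\,p^+<N,\quad p^+:=\max_{\overline\Omega\times\overline\Omega}p .$$ Put $\bar p(x)=p(x,x)$. Let $K:\mathbb R^N\times\mathbb R^N\to(0,\infty)$ be measurable such that (a) $K(x,y)=K(y,x)$ for all $x,y\in\mathbb R^N$; (b) there is $k_0>0$ with $K(x,y)\ge k_0|x-y|^{-(N+sp(x,y))}$ for all $x\ne y$ in $\mathbb R^N$; (c) $mK\in L^1(\Omega\times\mathbb R^N)$, where $m(x,y)=\min\{1,|x-y|^{p(x,y)}\}$. Let $Q=(\mathbb R^N\times\mathbb R^N)\setminus\big((\mathbb R^N\setminus\Omega)\times(\mathbb R^N\setminus\Omega)\big)$ and let $W^{K,p(x,y)}(\Omega)$ be the space of measurable $u:\mathbb R^N\to\mathbb R$ (identified when equal a.e.) such that $\int_\Omega|u(x)|^{\bar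 p(x)}\,dx<\infty$ and $$\int_Q\frac{|u(x)-u(y)|^{p(x,y)}}{\lambda^{p(x,y)}}K(x,y)\,dx\,dy<\infty\quad\text{for some }\lambda>0,$$ with the norm $\|u\|_{K,p(x,y)}=\|u\|_{L^{\bar p(x)}(\Omega)}+[u]_{K,p(x,y)}$, where $$\|u\|_{L^{\bar p(x)}(\Omega)}=\inf\Big\{\lambda>0:\int_\Omega\Big|\frac{u(x)}{\lambda}\Big|^{\bar p(x)}dx\le1\Big\},\qquad [u]_{K,p(x,y)}=\inf\Big\{\lambda>0:\int_Q\frac{|u(x)-u(y)|^{p(x,y)}}{\lambda^{p(x,y)}}K(x,y)\,dx\,dy\le1\Big\}.$$ Let $X_0=W_0^{K,p(x,y)}(\Omega)=\{u\in W^{K,p(x,y)}(\Omega):u=0\text{ a.e. in }\mathbb R^N\setminus\Omega\}$ with this norm, and let $X_0^*$ be its dual space. Then for every $f\in X_0^*$ the Dirichlet problem $\mathcal L_K^{p(x,\cdot)}u=f$ in $\Omega$, $u=0$ in $\mathbb R^N\setminus\Omega$, has a unique weak solution, that is, there is exactly one $u\in X_0$ such that for every $\varphi\in X_0$ the following integral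 converges absolutely and $$\int_{\mathbb R^N\times\mathbb R^N}|u(x)-u(y)|^{p(x,y)-2}(u(x)-u(y))(\varphi(x)-\varphi(y))K(x,y)\,dx\,dy=\langle f,\varphi\rangle .$$ -/

import Mathlib

open MeasureTheory Set

noncomputable section

namespace NonlocalDirichlet

/-- `ℝ^N` with its Euclidean norm and Lebesgue measure. -/
abbrev Eucl (N : ℕ) : Type := EuclideanSpace ℝ (Fin N)

variable {N : ℕ}

/-- A variable exponent on `ℝ^N × ℝ^N`: continuous, bounded, with values in `(1, ∞)`, with infimum
`p⁻ > 1`, and symmetric on `closure Ω × closure Ω`. -/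
structure IsVariableExponent (Ω : Set (Eucl N)) (p : Eucl N → Eucl N → ℝ) : Prop where
  continuous : Continuous fun z : Eucl N × Eucl N => p z.1 z.2
  one_lt : ∀ x y, 1 < p x y
  one_lt_iInf : 1 < ⨅ z : Eucl N × Eucl N, p z.1 z.2
  bddAbove : BddAbove (range fun z : Eucl N × Eucl N => p z.1 z.2)
  symm : ∀ x ∈ closure Ω, ∀ y ∈ closure Ω, p x y = p y x

/-- `p⁺`, the maximum of `p` over `closure Ω × closure Ω`. -/
def pPlus (Ω : Set (Eucl N)) (p : Eucl N → Eucl N → ℝ) : ℝ :=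
  sSup ((fun z : Eucl N × Eucl N => p z.1 z.2) '' (closure Ω ×ˢ closure Ω))

/-- The assumptions on the kernel `K : ℝ^N × ℝ^N → (0, ∞)`: measurability, symmetry, the lower
bound by a multiple of `|x - y| ^ (-(N + s p(x,y)))`, and the integrability over `Ω × ℝ^N` of
`m K`, where `m(x,y) = min {1, |x - y| ^ p(x,y)}`. -/
structure IsKernel (s : ℝ) (Ω : Set (Eucl N)) (p K : Eucl N → Eucl N → ℝ) : Prop where
  measurable : Measurable fun z : Eucl N × Eucl N => K z.1 z.2
  pos : ∀ x y, 0 < K x y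
  symm : ∀ x y, K x y = K y x
  lower_bound : ∃ k₀ : ℝ, 0 < k₀ ∧
    ∀ x y, x ≠ y → k₀ * ‖x - y‖ ^ (-((N : ℝ) + s * p x y)) ≤ K x y
  integrable : IntegrableOn
    (fun z : Eucl N × Eucl N => min 1 (‖z.1 - z.2‖ ^ p z.1 z.2) * K z.1 z.2)
    (Ω ×ˢ (univ : Set (Eucl N))) volume

/-- `Q = (ℝ^N × ℝ^N) \ (Ωᶜ × Ωᶜ)`. -/
def Q (Ω : Set (Eucl N)) : Set (Eucl N × Eucl N) := (Ωᶜ ×ˢ Ωᶜ)ᶜ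

/-- `∫_Ω |u(x)/lam| ^ p(x,x) dx`, with value in `[0, ∞]`. -/
def lebesgueModular (Ω : Set (Eucl N)) (p : Eucl N → Eucl N → ℝ)
    (u : Eucl N → ℝ) (lam : ℝ) : ENNReal :=
  ∫⁻ x in Ω, ENNReal.ofReal (|u x / lam| ^ p x x)

/-- `∫_Q |u(x) - u(y)| ^ p(x,y) / lam ^ p(x,y) K(x,y) dx dy`, with value in `[0, ∞]`. -/
def gagliardoModular (Ω : Set (Eucl N)) (p K : Eucl N → Eucl N → ℝ)
    (u : Eucl N → ℝ) (lam : ℝ) : ENNReal :=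
  ∫⁻ z in Q Ω, ENNReal.ofReal
    (|u z.1 - u z.2| ^ p z.1 z.2 / lam ^ p z.1 z.2 * K z.1 z.2)

/-- The Luxemburg norm of `u` in `L^{p(x,x)}(Ω)`. -/
def lebesgueNorm (Ω : Set (Eucl N)) (p : Eucl N → Eucl N → ℝ) (u : Eucl N → ℝ) : ℝ :=
  sInf {lam : ℝ | 0 < lam ∧ lebesgueModular Ω p u lam ≤ 1}

/-- The seminorm `[u]_{K,p(x,y)}`. -/
def gagliardoSeminorm (Ω : Set (Eucl N)) (p K : Eucl N → Eucl N → ℝ) (u : Eucl N → ℝ) : ℝ :=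
  sInf {lam : ℝ | 0 < lam ∧ gagliardoModular Ω p K u lam ≤ 1}

/-- The norm `‖u‖_{K,p(x,y)}` of `W^{K,p(x,y)}(Ω)`. -/
def normK (Ω : Set (Eucl N)) (p K : Eucl N → Eucl N → ℝ) (u : Eucl N → ℝ) : ℝ :=
  lebesgueNorm Ω p u + gagliardoSeminorm Ω p K u

/-- The two conditions that define `W^{K,p(x,y)}(Ω)` among the measurable functions. -/
def MemWK (Ω : Set (Eucl N)) (p K : Eucl N → Eucl N → ℝ) (u : Eucl N → ℝ) : Prop :=
  lebesgueModular Ω p u 1 < ⊤ ∧ ∃ lam : ℝ, 0 < lam ∧ gagliardoModular Ω p K u lam < ⊤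

variable {Ω : Set (Eucl N)} {p K : Eucl N → Eucl N → ℝ}

theorem lebesgueModular_congr {u v : Eucl N → ℝ} (h : u =ᵐ[volume] v) (lam : ℝ) :
    lebesgueModular Ω p u lam = lebesgueModular Ω p v lam := by
  refine lintegral_congr_ae ?_
  filter_upwards [ae_restrict_of_ae h] with x hx
  simp only [hx]

theorem gagliardoModular_congr {u v : Eucl N → ℝ} (h : u =ᵐ[volume] v) (lam : ℝ) :
    gagliardoModular Ω p K u lam = gagliardoModular Ω p K v lam := by
  refine lintegral_congr_ae (ae_restrict_of_ae ?_)
  have h1 : ∀ᵐ z : Eucl N × Eucl N, u z.1 = v z.1 :=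
    Measure.quasiMeasurePreserving_fst.ae h
  have h2 : ∀ᵐ z : Eucl N × Eucl N, u z.2 = v z.2 :=
    Measure.quasiMeasurePreserving_snd.ae h
  filter_upwards [h1, h2] with z hz1 hz2
  simp only [hz1, hz2]

theorem MemWK.congr {u v : Eucl N → ℝ} (h : u =ᵐ[volume] v) (hu : MemWK Ω p K u) :
    MemWK Ω p K v := by
  obtain ⟨h1, lam, hlam, h2⟩ := hu
  exact ⟨lebesgueModular_congr h 1 ▸ h1, lam, hlam, gagliardoModular_congr h lam ▸ h2⟩

theorem MemWK.zero (hp : IsVariableExponent Ω p) : MemWK Ω p K 0 := by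
  have h0 : ∀ x y, p x y ≠ 0 := fun x y => (zero_lt_one.trans (hp.one_lt x y)).ne'
  refine ⟨?_, 1, one_pos, ?_⟩
  · simp [lebesgueModular, Real.zero_rpow (h0 _ _)]
  · simp [gagliardoModular, Real.zero_rpow (h0 _ _)]

/-- `t ^ q ≤ a ^ q + b ^ q` as soon as `t ≤ max a b` (all numbers nonnegative). -/
theorem rpow_le_add_of_le_max {t a b q : ℝ} (ht : 0 ≤ t) (ha : 0 ≤ a) (hb : 0 ≤ b) (hq : 0 ≤ q)
    (h : t ≤ max a b) : t ^ q ≤ a ^ q + b ^ q := by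
  rcases le_max_iff.1 h with h | h
  · exact (Real.rpow_le_rpow ht h hq).trans (le_add_of_nonneg_right (Real.rpow_nonneg hb _))
  · exact (Real.rpow_le_rpow ht h hq).trans (le_add_of_nonneg_left (Real.rpow_nonneg ha _))

theorem MemWK.add (hp : IsVariableExponent Ω p)
    (hK : Measurable fun z : Eucl N × Eucl N => K z.1 z.2)
    {u v : Eucl N → ℝ} (hum : Measurable u)
    (hu : MemWK Ω p K u) (hv : MemWK Ω p K v) : MemWK Ω p K (u + v) := by
  have hp0 : ∀ x y, 0 ≤ p x y := fun x y => (zero_lt_one.trans (hp.one_lt x y)).le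
  have hpm : Measurable fun z : Eucl N × Eucl N => p z.1 z.2 := hp.continuous.measurable
  obtain ⟨P, hP⟩ := hp.bddAbove
  have hP' : ∀ x y, p x y ≤ P := fun x y => hP ⟨(x, y), rfl⟩
  obtain ⟨hu1, a, ha, hu2⟩ := hu
  obtain ⟨hv1, b, hb, hv2⟩ := hv
  refine ⟨?_, a + b, add_pos ha hb, ?_⟩
  · have hpd : Measurable fun x : Eucl N => p x x :=
      hpm.comp (measurable_id.prodMk measurable_id)
    have hm : Measurable fun x => ENNReal.ofReal (|u x / 1| ^ p x x) :=
      ENNReal.measurable_ofReal.comp (by fun_prop)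
    calc lebesgueModular Ω p (u + v) 1
        ≤ ∫⁻ x in Ω, ENNReal.ofReal (2 ^ P) *
            (ENNReal.ofReal (|u x / 1| ^ p x x) + ENNReal.ofReal (|v x / 1| ^ p x x)) := by
          refine lintegral_mono fun x => ?_
          rw [← ENNReal.ofReal_add (by positivity) (by positivity),
            ← ENNReal.ofReal_mul (by positivity)]
          refine ENNReal.ofReal_le_ofReal ?_
          have h1 : |(u + v) x / 1| ≤ max (2 * |u x / 1|) (2 * |v x / 1|) := by
            simp only [div_one, Pi.add_apply]
            have := abs_add_le (u x) (v x)
            rcases le_total |u x| |v x| with h | h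
            · exact le_max_of_le_right (by linarith)
            · exact le_max_of_le_left (by linarith)
          refine (rpow_le_add_of_le_max (abs_nonneg _) (by positivity) (by positivity)
            (hp0 x x) h1).trans ?_
          rw [Real.mul_rpow two_pos.le (abs_nonneg _), Real.mul_rpow two_pos.le (abs_nonneg _),
            ← mul_add]
          gcongr
          · norm_num
          · exact hP' x x
      _ = ENNReal.ofReal (2 ^ P) * (lebesgueModular Ω p u 1 + lebesgueModular Ω p v 1) := by
          rw [lintegral_const_mul' _ _ ENNReal.ofReal_ne_top, lintegral_add_left hm]
          rfl
      _ < ⊤ := ENNReal.mul_lt_top ENNReal.ofReal_lt_top (ENNReal.add_lt_top.2 ⟨hu1, hv1⟩)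
  · have hm : Measurable fun z : Eucl N × Eucl N => ENNReal.ofReal
        (|u z.1 - u z.2| ^ p z.1 z.2 / a ^ p z.1 z.2 * K z.1 z.2) :=
      ENNReal.measurable_ofReal.comp (by fun_prop)
    calc gagliardoModular Ω p K (u + v) (a + b)
        ≤ ∫⁻ z in Q Ω, (ENNReal.ofReal
              (|u z.1 - u z.2| ^ p z.1 z.2 / a ^ p z.1 z.2 * K z.1 z.2) +
            ENNReal.ofReal (|v z.1 - v z.2| ^ p z.1 z.2 / b ^ p z.1 z.2 * K z.1 z.2)) := by
          refine lintegral_mono fun z => ?_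
          rcases le_or_gt (K z.1 z.2) 0 with hKz | hKz
          · rw [ENNReal.ofReal_of_nonpos]
            · exact zero_le
            · exact mul_nonpos_of_nonneg_of_nonpos (by positivity) hKz
          rw [← ENNReal.ofReal_add (by positivity) (by positivity), ← add_mul]
          refine ENNReal.ofReal_le_ofReal (mul_le_mul_of_nonneg_right ?_ hKz.le)
          rw [← Real.div_rpow (abs_nonneg _) (by positivity), ← Real.div_rpow (abs_nonneg _) ha.le,
            ← Real.div_rpow (abs_nonneg _) hb.le]
          refine rpow_le_add_of_le_max (by positivity) (by positivity) (by positivity) (hp0 _ _) ?_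
          set c := |u z.1 - u z.2| / a with hc
          set d := |v z.1 - v z.2| / b with hd
          have hc' : |u z.1 - u z.2| = c * a := by rw [hc]; field_simp
          have hd' : |v z.1 - v z.2| = d * b := by rw [hd]; field_simp
          rw [div_le_iff₀ (by positivity)]
          have h1 : |(u + v) z.1 - (u + v) z.2| ≤ c * a + d * b := by
            rw [← hc', ← hd']
            refine le_trans (le_of_eq ?_) (abs_add_le _ _)
            simp only [Pi.add_apply]
            congr 1
            ring
          nlinarith [le_max_left c d, le_max_right c d]
      _ = gagliardoModular Ω p K u a + gagliardoModular Ω p K v b := lintegral_add_left hm _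
      _ < ⊤ := ENNReal.add_lt_top.2 ⟨hu2, hv2⟩

theorem MemWK.smul (hp : IsVariableExponent Ω p) (c : ℝ) {u : Eucl N → ℝ}
    (hu : MemWK Ω p K u) : MemWK Ω p K (c • u) := by
  have hp0 : ∀ x y, 0 ≤ p x y := fun x y => (zero_lt_one.trans (hp.one_lt x y)).le
  rcases eq_or_ne c 0 with rfl | hc
  · rw [zero_smul]; exact MemWK.zero hp
  obtain ⟨P, hP⟩ := hp.bddAbove
  have hP' : ∀ x y, p x y ≤ P := fun x y => hP ⟨(x, y), rfl⟩
  obtain ⟨hu1, a, ha, hu2⟩ := hu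
  have hc0 : 0 < |c| := abs_pos.2 hc
  refine ⟨?_, |c| * a, by positivity, ?_⟩
  · calc lebesgueModular Ω p (c • u) 1
        ≤ ∫⁻ x in Ω, ENNReal.ofReal (max 1 |c| ^ P) * ENNReal.ofReal (|u x / 1| ^ p x x) := by
          refine lintegral_mono fun x => ?_
          rw [← ENNReal.ofReal_mul (by positivity)]
          refine ENNReal.ofReal_le_ofReal ?_
          simp only [div_one, Pi.smul_apply, smul_eq_mul, abs_mul]
          rw [Real.mul_rpow (abs_nonneg _) (abs_nonneg _)]
          gcongr
          exact (Real.rpow_le_rpow (abs_nonneg _) (le_max_right _ _) (hp0 _ _)).trans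
            (Real.rpow_le_rpow_of_exponent_le (le_max_left _ _) (hP' _ _))
      _ = ENNReal.ofReal (max 1 |c| ^ P) * lebesgueModular Ω p u 1 :=
          lintegral_const_mul' _ _ ENNReal.ofReal_ne_top
      _ < ⊤ := ENNReal.mul_lt_top ENNReal.ofReal_lt_top hu1
  · refine lt_of_eq_of_lt (lintegral_congr fun z => ?_) hu2
    have h1 : |(c • u) z.1 - (c • u) z.2| = |c| * |u z.1 - u z.2| := by
      rw [← abs_mul, mul_sub]; rfl
    rw [h1, Real.mul_rpow hc0.le (abs_nonneg _), Real.mul_rpow hc0.le ha.le,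
      mul_div_mul_left _ _ (Real.rpow_pos_of_pos hc0 _).ne']

/-- The space `W^{K,p(x,y)}(Ω)`, functions being identified when equal almost everywhere. -/
def WK (hp : IsVariableExponent Ω p) (hK : Measurable fun z : Eucl N × Eucl N => K z.1 z.2) :
    Submodule ℝ (Eucl N →ₘ[volume] ℝ) where
  carrier := {u | MemWK Ω p K u}
  zero_mem' := (MemWK.zero hp).congr AEEqFun.coeFn_zero.symm
  add_mem' {u v} hu hv :=
    (MemWK.add hp hK u.measurable hu hv).congr (AEEqFun.coeFn_add u v).symm
  smul_mem' c u hu := (MemWK.smul hp c hu).congr (AEEqFun.coeFn_smul c u).symm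

/-- The subspace `W_0^{K,p(x,y)}(Ω)` of those `u ∈ W^{K,p(x,y)}(Ω)` that vanish almost everywhere
outside `Ω`. -/
def WK0 (hp : IsVariableExponent Ω p) (hK : Measurable fun z : Eucl N × Eucl N => K z.1 z.2) :
    Submodule ℝ (Eucl N →ₘ[volume] ℝ) where
  carrier := {u | u ∈ WK hp hK ∧ ∀ᵐ x : Eucl N, x ∉ Ω → u x = 0}
  zero_mem' := ⟨zero_mem _, by
    filter_upwards [AEEqFun.coeFn_zero (α := Eucl N) (μ := volume) (β := ℝ)] with x hx _
    exact hx⟩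
  add_mem' {u v} hu hv := ⟨add_mem hu.1 hv.1, by
    filter_upwards [AEEqFun.coeFn_add u v, hu.2, hv.2] with x hx h1 h2 hxΩ
    rw [hx, Pi.add_apply, h1 hxΩ, h2 hxΩ, add_zero]⟩
  smul_mem' c u hu := ⟨Submodule.smul_mem _ c hu.1, by
    filter_upwards [AEEqFun.coeFn_smul c u, hu.2] with x hx h1 hxΩ
    rw [hx, Pi.smul_apply, h1 hxΩ, smul_zero]⟩

variable {hp : IsVariableExponent Ω p} {hK : Measurable fun z : Eucl N × Eucl N => K z.1 z.2}

/-- A linear functional on `W_0^{K,p(x,y)}(Ω)` belongs to the dual space `(W_0^{K,p(x,y)}(Ω))^*`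
when it is bounded with respect to the norm `‖·‖_{K,p(x,y)}`. -/
def MemDual (f : WK0 hp hK →ₗ[ℝ] ℝ) : Prop :=
  ∃ C : ℝ, ∀ φ : WK0 hp hK, |f φ| ≤ C * normK Ω p K (φ : Eucl N →ₘ[volume] ℝ)

/-- `|u(x) - u(y)| ^ (p(x,y) - 2) (u(x) - u(y)) (φ(x) - φ(y)) K(x,y)` at `z = (x, y)`. -/
def weakIntegrand (p K : Eucl N → Eucl N → ℝ) (u φ : Eucl N → ℝ) (z : Eucl N × Eucl N) : ℝ :=
  |u z.1 - u z.2| ^ (p z.1 z.2 - 2) * (u z.1 - u z.2) * (φ z.1 - φ z.2) * K z.1 z.2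

/-- `u` is a weak solution of `L_K^{p(x,·)} u = f` in `Ω`, `u = 0` in `ℝ^N \ Ω`: for every
`φ ∈ W_0^{K,p(x,y)}(Ω)` the integral over `ℝ^N × ℝ^N` converges absolutely and equals `⟨f, φ⟩`. -/
def IsWeakSolution (f : WK0 hp hK →ₗ[ℝ] ℝ) (u : WK0 hp hK) : Prop :=
  ∀ φ : WK0 hp hK,
    Integrable (weakIntegrand p K (u : Eucl N →ₘ[volume] ℝ) (φ : Eucl N →ₘ[volume] ℝ)) volume ∧
    ∫ z : Eucl N × Eucl N,
      weakIntegrand p K (u : Eucl N →ₘ[volume] ℝ) (φ : Eucl N →ₘ[volume] ℝ) z = f φ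

end NonlocalDirichlet

end

namespace NonlocalDirichlet

/-! ### Convexity, monotonicity and differentiability of the powers `|·| ^ q`. -/

section RealPowers

open Filter Topology

/-! The equation is the Euler-Lagrange equation of `J(u) = ∫ |u(x) - u(y)| ^ p / p dν - f u` on
`X₀`, where `dν = K dx dy`, so the solution is the minimizer of a strictly convex functional. No
reflexivity or weak compactness is used. The powers `|·| ^ q` are uniformly convex, uniformly for
`q` in a compact part of `(1, ∞)` (`exists_abs_sub_rpow_le`), and therefore a minimizing sequence is
Cauchy for the modular `∫ |u(x) - u(y)| ^ p dν`. Fatou's lemma shows that its limit is a minimizer.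
Uniqueness comes from the strict monotonicity of `t ↦ |t| ^ (q - 2) t`.

This argument is carried out for an abstract almost everywhere linear map `D`
(`IsModularMap.existsUnique_integral_eq`), later taken to be `u ↦ u(x) - u(y)`. It needs three
facts: `D` is injective, modular Cauchy sequences have a subsequence along which `D u` converges
a.e. to some `D w`, and `f` is bounded on the unit ball of the modular.

These facts rest on two estimates for functions that vanish outside `Ω`. The first is an `L¹` bound
by the modular, obtained by comparing `u` on `Ω` with its zero values on a ball outside `Ω`
(`exists_lintegral_abs_le`). The second is a modular Poincaré inequality
(`exists_lebesgueModular_le`). It follows from the pointwise bound `|u(x)| ^ p(x,x) ≤ C (1 + G(x))`,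
where `G(x)` is the integral over `y` of the Gagliardo density. To prove this bound, `u` is averaged
over a ball around `x` whose radius shrinks as a small negative power of `1 + G(x)`. The factor
`radius ^ (s p)` supplied by the singularity of `K` then pays for the oscillation of `p` on the
ball, while the `L¹` bound controls the average of `|u|`. Continuity of `p` suffices; no modulus of
continuity is needed. -/

theorem abs_midpoint_rpow_le {q : ℝ} (hq : 1 < q) (a b : ℝ) :
    |(a + b) / 2| ^ q ≤ (|a| ^ q + |b| ^ q) / 2 := by
  have h1 : |(a + b) / 2| ≤ (1 / 2 : ℝ) • |a| + (1 / 2 : ℝ) • |b| := by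
    rw [abs_div, abs_two]
    have := abs_add_le a b
    simp only [smul_eq_mul]
    linarith
  have h2 := (strictConvexOn_rpow hq).convexOn.2 (mem_Ici.2 (abs_nonneg a))
    (mem_Ici.2 (abs_nonneg b)) (by norm_num : (0 : ℝ) ≤ 1 / 2) (by norm_num : (0 : ℝ) ≤ 1 / 2)
    (by norm_num)
  have h3 := Real.rpow_le_rpow (abs_nonneg _) h1 (by linarith : 0 ≤ q)
  simp only [smul_eq_mul] at h2 h3
  linarith

/-- Strict convexity of `t ^ q` on `[0, ∞)` settles the case `|a| ≠ |b|`. Otherwise `a = -b ≠ 0` and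
the midpoint is `0`. -/
theorem abs_midpoint_rpow_lt {q : ℝ} (hq : 1 < q) {a b : ℝ} (hab : a ≠ b) :
    |(a + b) / 2| ^ q < (|a| ^ q + |b| ^ q) / 2 := by
  rcases eq_or_ne |a| |b| with h | h
  · rcases abs_eq_abs.1 h with h' | h'
    · exact absurd h' hab
    · have hb : 0 < |b| := abs_pos.2 fun hb => hab (by rw [h', hb, neg_zero])
      have : (a + b) / 2 = 0 := by rw [h']; ring
      rw [this, abs_zero, Real.zero_rpow (by linarith), h]
      have := Real.rpow_pos_of_pos hb q
      linarith
  · have h1 : |(a + b) / 2| ≤ (1 / 2 : ℝ) • |a| + (1 / 2 : ℝ) • |b| := by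
      rw [abs_div, abs_two]
      have := abs_add_le a b
      simp only [smul_eq_mul]
      linarith
    have h2 := (strictConvexOn_rpow hq).2 (mem_Ici.2 (abs_nonneg a))
      (mem_Ici.2 (abs_nonneg b)) h (by norm_num : (0 : ℝ) < 1 / 2)
      (by norm_num : (0 : ℝ) < 1 / 2) (by norm_num)
    have h3 := Real.rpow_le_rpow (abs_nonneg _) h1 (by linarith : 0 ≤ q)
    simp only [smul_eq_mul] at h2 h3
    linarith

/-- Uniform convexity of the powers `|·| ^ q`, uniformly for `q` in a compact subset of
`(1, ∞)`. -/
theorem exists_abs_sub_rpow_le {m P : ℝ} (hm : 1 < m) {ε : ℝ} (hε : 0 < ε) :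
    ∃ C : ℝ, 0 ≤ C ∧ ∀ q, m ≤ q → q ≤ P → ∀ a b : ℝ,
      |a - b| ^ q ≤ ε * (|a| ^ q + |b| ^ q) +
        C * ((|a| ^ q + |b| ^ q) / 2 - |(a + b) / 2| ^ q) := by
  -- Both sides are homogeneous of degree `q` in `(a, b)`, so it suffices to treat the unit sphere
  -- of the sup norm, which together with the exponent interval forms a compact set.
  set S : Set ((ℝ × ℝ) × ℝ) := Metric.sphere 0 1 ×ˢ Icc m P with hS
  have hSc : IsCompact S := (isCompact_sphere _ _).prod isCompact_Icc
  set h : (ℝ × ℝ) × ℝ → ℝ := fun z =>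
    |z.1.1 - z.1.2| ^ z.2 - ε * (|z.1.1| ^ z.2 + |z.1.2| ^ z.2) with hh
  set F : (ℝ × ℝ) × ℝ → ℝ := fun z =>
    (|z.1.1| ^ z.2 + |z.1.2| ^ z.2) / 2 - |(z.1.1 + z.1.2) / 2| ^ z.2 with hF
  have hpos : ∀ z ∈ S, 0 < z.2 := fun z hz => by linarith [hz.2.1]
  have key : ∀ g : (ℝ × ℝ) × ℝ → ℝ, Continuous g → ContinuousOn (fun z => |g z| ^ z.2) S :=
    fun g hg => (hg.abs.continuousOn).rpow continuous_snd.continuousOn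
      fun z hz => Or.inr (hpos z hz)
  have c1 := key (fun z => z.1.1) (by fun_prop)
  have c2 := key (fun z => z.1.2) (by fun_prop)
  have c3 := key (fun z => z.1.1 - z.1.2) (by fun_prop)
  have c4 := key (fun z => (z.1.1 + z.1.2) / 2) (by fun_prop)
  have hhc : ContinuousOn h S := c3.sub (continuousOn_const.mul (c1.add c2))
  have hFc : ContinuousOn F S := ((c1.add c2).div_const 2).sub c4
  have hmain : ∃ C : ℝ, 0 ≤ C ∧ ∀ z ∈ S, h z ≤ C * F z := by
    obtain ⟨H, hH⟩ := (hSc.image_of_continuousOn hhc).bddAbove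
    have hH' : ∀ z ∈ S, h z ≤ H := fun z hz => hH ⟨z, hz, rfl⟩
    -- Off `T` the bound holds trivially, the convexity defect `F` being nonnegative. On the compact
    -- set `T` the defect has a positive minimum, and `C` is the ratio of a bound for `h` to this
    -- minimum.
    set T := S ∩ h ⁻¹' Ici 0 with hT
    have hTc : IsCompact T :=
      hSc.of_isClosed_subset (hhc.preimage_isClosed_of_isClosed hSc.isClosed isClosed_Ici)
        inter_subset_left
    have hF0 : ∀ z ∈ S, 0 ≤ F z := fun z hz =>
      sub_nonneg.2 (abs_midpoint_rpow_le (hm.trans_le hz.2.1) _ _)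
    rcases T.eq_empty_or_nonempty with hTe | hTn
    · refine ⟨0, le_rfl, fun z hz => ?_⟩
      rw [zero_mul]
      by_contra hcon
      have : z ∈ T := ⟨hz, (not_le.1 hcon).le⟩
      rw [hTe] at this
      exact this
    · obtain ⟨z₀, hz₀, hmin⟩ := hTc.exists_isMinOn hTn (hFc.mono inter_subset_left)
      -- The defect vanishes only for `a = b`. On the sphere this gives `h = -2 ε < 0`, so such
      -- points are not in `T`.
      have hd : 0 < F z₀ := by
        refine sub_pos.2 (abs_midpoint_rpow_lt (hm.trans_le hz₀.1.2.1) fun hab => ?_)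
        have h0 : 0 ≤ h z₀ := hz₀.2
        have hq := hpos z₀ hz₀.1
        have hn : ‖z₀.1‖ = 1 := by simpa using hz₀.1.1
        have h1 : ‖z₀.1‖ = |z₀.1.2| := by
          rw [Prod.norm_def, hab, max_self, Real.norm_eq_abs]
        simp only [hh, hab, sub_self, abs_zero, Real.zero_rpow hq.ne', ← h1, hn,
          Real.one_rpow] at h0
        linarith
      have hH0 : 0 ≤ H := le_trans hz₀.2 (hH' z₀ hz₀.1)
      refine ⟨H / F z₀, by positivity, fun z hz => ?_⟩
      rcases lt_or_ge (h z) 0 with hz0 | hz0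
      · exact hz0.le.trans (mul_nonneg (by positivity) (hF0 z hz))
      · have h1 : F z₀ ≤ F z := hmin ⟨hz, hz0⟩
        calc h z ≤ H := hH' z hz
          _ = H / F z₀ * F z₀ := by field_simp
          _ ≤ H / F z₀ * F z := by gcongr
  obtain ⟨C, hC, hCz⟩ := hmain
  refine ⟨C, hC, fun q hmq hqP a b => ?_⟩
  have hq : 0 < q := by linarith
  set r : ℝ := ‖((a, b) : ℝ × ℝ)‖ with hr
  rcases eq_or_lt_of_le (norm_nonneg ((a, b) : ℝ × ℝ)) with h0 | h0
  · have h1 := norm_eq_zero.1 h0.symm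
    obtain ⟨rfl, rfl⟩ := Prod.mk.inj h1
    simp [Real.zero_rpow hq.ne']
  · have hz : (((r⁻¹ * a, r⁻¹ * b), q) : (ℝ × ℝ) × ℝ) ∈ S := by
      refine ⟨?_, hmq, hqP⟩
      have : ((r⁻¹ * a, r⁻¹ * b) : ℝ × ℝ) = r⁻¹ • (a, b) := rfl
      simp only [mem_sphere_iff_norm, sub_zero]
      rw [this, norm_smul, norm_inv, Real.norm_of_nonneg h0.le, inv_mul_cancel₀ h0.ne']
    have hsc : ∀ t : ℝ, |r⁻¹ * t| ^ q = (r ^ q)⁻¹ * |t| ^ q := fun t => by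
      rw [abs_mul, Real.mul_rpow (abs_nonneg _) (abs_nonneg _), abs_of_pos (inv_pos.2 h0),
        Real.inv_rpow h0.le]
    have := hCz _ hz
    have e1 : r⁻¹ * a - r⁻¹ * b = r⁻¹ * (a - b) := by ring
    have e2 : (r⁻¹ * a + r⁻¹ * b) / 2 = r⁻¹ * ((a + b) / 2) := by ring
    simp only [hh, hF, e1, e2, hsc] at this
    have hrq : 0 < r ^ q := Real.rpow_pos_of_pos h0 q
    have h3 := mul_le_mul_of_nonneg_left this hrq.le
    have h4 : r ^ q * (r ^ q)⁻¹ = 1 := mul_inv_cancel₀ hrq.ne'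
    have e3 : r ^ q * ((r ^ q)⁻¹ * |a - b| ^ q -
        ε * ((r ^ q)⁻¹ * |a| ^ q + (r ^ q)⁻¹ * |b| ^ q)) =
        (r ^ q * (r ^ q)⁻¹) * (|a - b| ^ q - ε * (|a| ^ q + |b| ^ q)) := by ring
    have e4 : r ^ q * (C * (((r ^ q)⁻¹ * |a| ^ q + (r ^ q)⁻¹ * |b| ^ q) / 2 -
        (r ^ q)⁻¹ * |(a + b) / 2| ^ q)) =
        (r ^ q * (r ^ q)⁻¹) * (C * ((|a| ^ q + |b| ^ q) / 2 - |(a + b) / 2| ^ q)) := by ring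
    rw [e3, e4, h4, one_mul, one_mul] at h3
    linarith

theorem abs_rpow_sub_two_mul_self_strictMono {q : ℝ} (hq : 1 < q) :
    StrictMono fun x : ℝ => |x| ^ (q - 2) * x := by
  have hpos : ∀ x : ℝ, 0 ≤ x → |x| ^ (q - 2) * x = x ^ (q - 1) := fun x hx => by
    rcases eq_or_lt_of_le hx with rfl | hx
    · rw [mul_zero, Real.zero_rpow (by linarith)]
    · rw [abs_of_pos hx, ← Real.rpow_add_one hx.ne']
      congr 1
      ring
  have hlt : ∀ x y : ℝ, 0 ≤ x → x < y → |x| ^ (q - 2) * x < |y| ^ (q - 2) * y :=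
    fun x y hx hxy => by
      rw [hpos x hx, hpos y (hx.trans hxy.le)]
      exact Real.rpow_lt_rpow hx hxy (by linarith)
  intro x y hxy
  show |x| ^ (q - 2) * x < |y| ^ (q - 2) * y
  rcases le_or_gt 0 x with hx | hx
  · exact hlt x y hx hxy
  rcases le_or_gt y 0 with hy | hy
  · have := hlt (-y) (-x) (by linarith) (by linarith)
    simp only [abs_neg] at this
    linarith
  · have h1 : |x| ^ (q - 2) * x < 0 :=
      mul_neg_of_pos_of_neg (Real.rpow_pos_of_pos (abs_pos.2 hx.ne) _) hx
    have h2 : 0 < |y| ^ (q - 2) * y :=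
      mul_pos (Real.rpow_pos_of_pos (abs_pos.2 hy.ne') _) hy
    linarith

theorem hasDerivAt_abs_affine_rpow_div {q : ℝ} (hq : 1 < q) (a b t : ℝ) :
    HasDerivAt (fun t : ℝ => |a + t * b| ^ q / q)
      (|a + t * b| ^ (q - 2) * (a + t * b) * b) t := by
  have h1 : HasDerivAt (fun t : ℝ => a + t * b) b t := by
    simpa using ((hasDerivAt_id t).mul_const b).const_add a
  have h2 := ((hasDerivAt_abs_rpow (a + t * b) hq).comp t h1).div_const q
  refine h2.congr_deriv ?_
  have : q ≠ 0 := by linarith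
  field_simp

/-- Young-type domination of `|a| ^ (q - 2) a b`. -/
theorem abs_rpow_sub_two_mul_mul_le {q : ℝ} (hq : 1 < q) {a b c d : ℝ} (ha : |a| ≤ c + d)
    (hb : |b| ≤ d) (hc : 0 ≤ c) :
    |(|a| ^ (q - 2) * a * b)| ≤ (c + d) ^ q := by
  have hd : 0 ≤ d := (abs_nonneg b).trans hb
  have h1 : |(|a| ^ (q - 2) * a * b)| = |a| ^ (q - 1) * |b| := by
    rw [abs_mul, abs_mul, abs_of_nonneg (Real.rpow_nonneg (abs_nonneg a) _)]
    congr 1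
    rcases eq_or_lt_of_le (abs_nonneg a) with h | h
    · rw [← h, mul_zero, Real.zero_rpow (by linarith)]
    · rw [← Real.rpow_add_one h.ne']
      congr 1
      ring
  rw [h1]
  rcases eq_or_lt_of_le (add_nonneg hc hd) with h | h
  · have : |b| = 0 := le_antisymm (by linarith) (abs_nonneg b)
    rw [this, mul_zero]
    positivity
  · calc |a| ^ (q - 1) * |b| ≤ (c + d) ^ (q - 1) * (c + d) := by
          gcongr
          linarith
      _ = (c + d) ^ q := by
          rw [← Real.rpow_add_one h.ne']
          congr 1
          ring

end RealPowers

end NonlocalDirichlet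

namespace NonlocalDirichlet

/-! ### Minimization of a convex modular energy minus a linear functional. -/

section Variational

open Filter Topology

variable {Z V : Type*} [MeasurableSpace Z] [AddCommGroup V] [Module ℝ V]

/-- An almost everywhere linear map `D` from a vector space to the measurable functions `v` with
`∫ |v| ^ q < ∞`, for a variable exponent `q` with values in `[m, P] ⊆ (1, ∞)`. -/
structure IsModularMap (μ : Measure Z) (q : Z → ℝ) (m P : ℝ) (D : V → Z → ℝ) : Prop where
  measurable_exponent : Measurable q
  one_lt : 1 < m
  le_exponent : ∀ z, m ≤ q z
  exponent_le : ∀ z, q z ≤ P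
  measurable : ∀ u, Measurable (D u)
  add : ∀ u v, D (u + v) =ᵐ[μ] fun z => D u z + D v z
  smul : ∀ (c : ℝ) u, D (c • u) =ᵐ[μ] fun z => c * D u z
  integrable : ∀ u, Integrable (fun z => |D u z| ^ q z) μ

/-- Fatou's lemma for a sequence of nonnegative functions with bounded Bochner integrals. -/
theorem integrable_and_integral_le_of_ae_tendsto {μ : Measure Z} {g : ℕ → Z → ℝ} {h : Z → ℝ}
    {M : ℝ} (hgm : ∀ n, Measurable (g n)) (hg0 : ∀ n z, 0 ≤ g n z)
    (hgi : ∀ n, Integrable (g n) μ) (hgM : ∀ᶠ n in atTop, ∫ z, g n z ∂μ ≤ M)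
    (hlim : ∀ᵐ z ∂μ, Tendsto (fun n => g n z) atTop (𝓝 (h z))) :
    Integrable h μ ∧ ∫ z, h z ∂μ ≤ M := by
  have hh0 : ∀ᵐ z ∂μ, 0 ≤ h z := by
    filter_upwards [hlim] with z hz
    exact ge_of_tendsto' hz fun n => hg0 n z
  have hhm : AEMeasurable h μ :=
    aemeasurable_of_tendsto_metrizable_ae atTop (fun n => (hgm n).aemeasurable) hlim
  have hM0 : 0 ≤ M := by
    obtain ⟨n, hn⟩ := hgM.exists
    exact (integral_nonneg (hg0 n)).trans hn
  have hle : ∫⁻ z, ENNReal.ofReal (h z) ∂μ ≤ ENNReal.ofReal M := by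
    calc ∫⁻ z, ENNReal.ofReal (h z) ∂μ
        = ∫⁻ z, liminf (fun n => ENNReal.ofReal (g n z)) atTop ∂μ := by
          refine lintegral_congr_ae ?_
          filter_upwards [hlim] with z hz
          exact ((ENNReal.tendsto_ofReal hz).liminf_eq).symm
      _ ≤ liminf (fun n => ∫⁻ z, ENNReal.ofReal (g n z) ∂μ) atTop :=
          lintegral_liminf_le fun n => (hgm n).ennreal_ofReal
      _ ≤ liminf (fun _ : ℕ => ENNReal.ofReal M) atTop := by
          refine liminf_le_liminf ?_
          filter_upwards [hgM] with n hn
          rw [← ofReal_integral_eq_lintegral_ofReal (hgi n) (Eventually.of_forall (hg0 n))]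
          exact ENNReal.ofReal_le_ofReal hn
      _ = ENNReal.ofReal M := by simp
  have hint : Integrable h μ :=
    (lintegral_ofReal_ne_top_iff_integrable hhm.aestronglyMeasurable hh0).1
      (ne_top_of_le_ne_top ENNReal.ofReal_ne_top hle)
  refine ⟨hint, ?_⟩
  rw [← ofReal_integral_eq_lintegral_ofReal hint hh0] at hle
  exact (ENNReal.ofReal_le_ofReal_iff hM0).1 hle

namespace IsModularMap

variable {μ : Measure Z} {q : Z → ℝ} {m P : ℝ} {D : V → Z → ℝ}

/-- `∫ |D u| ^ q`. -/
noncomputable def modular (μ : Measure Z) (q : Z → ℝ) (D : V → Z → ℝ) (u : V) : ℝ :=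
  ∫ z, |D u z| ^ q z ∂μ

/-- `∫ |D u| ^ q / q`. -/
noncomputable def energy (μ : Measure Z) (q : Z → ℝ) (D : V → Z → ℝ) (u : V) : ℝ :=
  ∫ z, |D u z| ^ q z / q z ∂μ

theorem one_lt_exponent (H : IsModularMap μ q m P D) (z : Z) : 1 < q z :=
  H.one_lt.trans_le (H.le_exponent z)

theorem measurable_rpow (H : IsModularMap μ q m P D) (u : V) :
    Measurable fun z => |D u z| ^ q z := by
  have := H.measurable u
  have := H.measurable_exponent
  fun_prop

theorem measurable_rpow_div (H : IsModularMap μ q m P D) (u : V) :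
    Measurable fun z => |D u z| ^ q z / q z :=
  (H.measurable_rpow u).div H.measurable_exponent

theorem rpow_div_le (H : IsModularMap μ q m P D) (u : V) (z : Z) :
    |D u z| ^ q z / q z ≤ |D u z| ^ q z :=
  div_le_self (Real.rpow_nonneg (abs_nonneg _) _) (H.one_lt_exponent z).le

theorem rpow_div_nonneg (H : IsModularMap μ q m P D) (u : V) (z : Z) :
    0 ≤ |D u z| ^ q z / q z :=
  div_nonneg (Real.rpow_nonneg (abs_nonneg _) _) (zero_lt_one.trans (H.one_lt_exponent z)).le

theorem integrable_div (H : IsModularMap μ q m P D) (u : V) :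
    Integrable (fun z => |D u z| ^ q z / q z) μ := by
  refine (H.integrable u).mono (H.measurable_rpow_div u).aestronglyMeasurable
    (Eventually.of_forall fun z => ?_)
  rw [Real.norm_of_nonneg (H.rpow_div_nonneg u z),
    Real.norm_of_nonneg (Real.rpow_nonneg (abs_nonneg _) _)]
  exact H.rpow_div_le u z

theorem sub (H : IsModularMap μ q m P D) (u v : V) :
    D (u - v) =ᵐ[μ] fun z => D u z - D v z := by
  have h1 := H.add u ((-1 : ℝ) • v)
  rw [neg_one_smul, ← sub_eq_add_neg] at h1
  have h2 := H.smul (-1) v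
  rw [neg_one_smul] at h2
  filter_upwards [h1, h2] with z h1 h2
  rw [h1, h2]
  ring

omit [AddCommGroup V] [Module ℝ V] in
theorem modular_nonneg (u : V) : 0 ≤ modular μ q D u :=
  integral_nonneg fun _ => Real.rpow_nonneg (abs_nonneg _) _

theorem modular_le_mul_energy (H : IsModularMap μ q m P D) (u : V) :
    modular μ q D u ≤ P * energy μ q D u := by
  rw [energy, ← integral_const_mul]
  refine integral_mono (H.integrable u) ((H.integrable_div u).const_mul P) fun z => ?_
  have h1 := H.rpow_div_nonneg u z
  have h2 : q z ≠ 0 := by linarith [H.one_lt_exponent z]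
  calc |D u z| ^ q z = q z * (|D u z| ^ q z / q z) := by field_simp
    _ ≤ P * (|D u z| ^ q z / q z) := by
      gcongr
      exact H.exponent_le z

theorem modular_smul_le (H : IsModularMap μ q m P D) {c : ℝ} (hc : 1 ≤ c) (u : V) :
    modular μ q D (c • u) ≤ c ^ P * modular μ q D u := by
  rw [modular, modular, ← integral_const_mul]
  refine integral_mono_ae (H.integrable _) ((H.integrable u).const_mul _) ?_
  filter_upwards [H.smul c u] with z hz
  have hc0 : 0 ≤ c := zero_le_one.trans hc
  rw [hz, abs_mul, Real.mul_rpow (abs_nonneg _) (abs_nonneg _), abs_of_nonneg hc0]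
  gcongr
  exact H.exponent_le z

theorem modular_inv_smul_le (H : IsModularMap μ q m P D) {c : ℝ} (hc : 1 ≤ c) (u : V) :
    modular μ q D (c⁻¹ • u) ≤ (c ^ m)⁻¹ * modular μ q D u := by
  rw [modular, modular, ← integral_const_mul]
  refine integral_mono_ae (H.integrable _) ((H.integrable u).const_mul _) ?_
  filter_upwards [H.smul c⁻¹ u] with z hz
  have hc0 : 0 < c := zero_lt_one.trans_le hc
  rw [hz, abs_mul, Real.mul_rpow (abs_nonneg _) (abs_nonneg _), abs_of_pos (inv_pos.2 hc0),
    Real.inv_rpow hc0.le]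
  gcongr
  exact H.le_exponent z

/-- Uniform convexity of the energy, by integration of `exists_abs_sub_rpow_le`. The energy carries
the weight `1 / q`, and restoring it costs a factor `q ≤ |P|`. The absolute value is there because
nothing makes `P` nonnegative when `Z` is empty. -/
theorem exists_modular_sub_le (H : IsModularMap μ q m P D) {ε : ℝ} (hε : 0 < ε) :
    ∃ C : ℝ, 0 ≤ C ∧ ∀ u v : V, modular μ q D (u - v) ≤
      ε * (modular μ q D u + modular μ q D v) +
      C * ((energy μ q D u + energy μ q D v) / 2 - energy μ q D ((1 / 2 : ℝ) • (u + v))) := by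
  obtain ⟨C, hC, hCle⟩ := exists_abs_sub_rpow_le (P := P) H.one_lt hε
  refine ⟨C * |P|, by positivity, fun u v => ?_⟩
  · have iuv := ((H.integrable u).add (H.integrable v)).const_mul ε
    have ju := H.integrable_div u
    have jv := H.integrable_div v
    have jw := H.integrable_div ((1 / 2 : ℝ) • (u + v))
    have jd := (((ju.add jv).div_const 2).sub jw).const_mul (C * |P|)
    have e1 : ε * (modular μ q D u + modular μ q D v) +
        C * |P| * ((energy μ q D u + energy μ q D v) / 2 -
          energy μ q D ((1 / 2 : ℝ) • (u + v))) =
        ∫ z, (ε * (|D u z| ^ q z + |D v z| ^ q z) +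
          C * |P| * ((|D u z| ^ q z / q z + |D v z| ^ q z / q z) / 2 -
            |D ((1 / 2 : ℝ) • (u + v)) z| ^ q z / q z)) ∂μ := by
      simp only [modular, energy]
      rw [← integral_add (H.integrable u) (H.integrable v), ← integral_add ju jv,
        ← integral_div, ← integral_const_mul]
      erw [← integral_sub ((ju.add jv).div_const 2) jw]
      rw [← integral_const_mul]
      exact (integral_add iuv jd).symm
    rw [e1]
    refine integral_mono_ae (H.integrable _) (iuv.add jd) ?_
    filter_upwards [H.sub u v, H.smul (1 / 2 : ℝ) (u + v), H.add u v] with z h1 h2 h3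
    have e : 1 / 2 * (D u z + D v z) = (D u z + D v z) / 2 := by ring
    rw [h1, h2, h3, e]
    have hq := H.one_lt_exponent z
    have hq0 : q z ≠ 0 := by linarith
    refine (hCle (q z) (H.le_exponent z) (H.exponent_le z) (D u z) (D v z)).trans ?_
    have hd := sub_nonneg.2 (abs_midpoint_rpow_le hq (D u z) (D v z))
    set d := (|D u z| ^ q z + |D v z| ^ q z) / 2 - |(D u z + D v z) / 2| ^ q z
    have e2 : (|D u z| ^ q z / q z + |D v z| ^ q z / q z) / 2 -
        |(D u z + D v z) / 2| ^ q z / q z = d / q z := by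
      simp only [d]
      field_simp
    rw [e2]
    have e3 : d ≤ |P| * (d / q z) := by
      calc d = q z * (d / q z) := by field_simp
        _ ≤ |P| * (d / q z) := by
          have := (H.exponent_le z).trans (le_abs_self P)
          gcongr
    have := mul_le_mul_of_nonneg_left e3 hC
    linarith

variable {f : V →ₗ[ℝ] ℝ} {C : ℝ}

theorem functional_bound_nonneg (H : IsModularMap μ q m P D)
    (hf : ∀ φ, modular μ q D φ ≤ 1 → |f φ| ≤ C) : 0 ≤ C := by
  refine (abs_nonneg (f 0)).trans (hf 0 ?_)
  have h := H.smul 0 (0 : V)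
  rw [zero_smul] at h
  rw [modular, integral_congr_ae (g := fun _ => 0)]
  · simp
  · filter_upwards [h] with z hz
    rw [hz, zero_mul, abs_zero, Real.zero_rpow (by linarith [H.one_lt_exponent z])]

/-- If the modular of `u` is at most `c ^ m` with `c ≥ 1`, then `c⁻¹ • u` lies in the unit ball and
`|f u| ≤ C c`. So `|f|` grows at most like the power `1 / m < 1` of the modular, and the coefficient
of the modular is as small as desired once `L` is large. This gives the coercivity of `energy - f`.
-/
theorem abs_functional_le (H : IsModularMap μ q m P D)
    (hf : ∀ φ, modular μ q D φ ≤ 1 → |f φ| ≤ C) {L : ℝ} (hL : 1 ≤ L) (u : V) :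
    |f u| ≤ C * L + C * (L ^ (m - 1))⁻¹ * modular μ q D u := by
  have hC := H.functional_bound_nonneg hf
  have hm0 : 0 < m := by linarith [H.one_lt]
  have hscale : ∀ c : ℝ, 1 ≤ c → modular μ q D u ≤ c ^ m → |f u| ≤ C * c := fun c hc hle => by
    have hc0 : 0 < c := by linarith
    have h1 : modular μ q D (c⁻¹ • u) ≤ 1 := by
      refine (H.modular_inv_smul_le hc u).trans ?_
      rw [inv_mul_le_iff₀ (Real.rpow_pos_of_pos hc0 m), mul_one]
      exact hle
    have h2 := hf _ h1
    rw [map_smul, smul_eq_mul, abs_mul, abs_of_pos (inv_pos.2 hc0),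
      inv_mul_le_iff₀ hc0] at h2
    linarith
  have hM := modular_nonneg (μ := μ) (q := q) (D := D) u
  have hL0 : 0 < L := by linarith
  rcases le_total (modular μ q D u) (L ^ m) with h | h
  · refine (hscale L hL h).trans (le_add_of_nonneg_right ?_)
    positivity
  -- Here `c = r` is admissible, and `r = r ^ m / r ^ (m - 1)` with `r ≥ L`.
  · set r := modular μ q D u ^ m⁻¹ with hr
    have hLr : L ≤ r := by
      have := Real.rpow_le_rpow (by positivity) h (by positivity : 0 ≤ m⁻¹)
      rwa [Real.rpow_rpow_inv hL0.le hm0.ne'] at this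
    have hr0 : 0 < r := by linarith
    have hrm : r ^ m = modular μ q D u := Real.rpow_inv_rpow hM hm0.ne'
    refine (hscale r (hL.trans hLr) hrm.ge).trans ?_
    have h3 : r ≤ (L ^ (m - 1))⁻¹ * modular μ q D u := by
      rw [← hrm, le_inv_mul_iff₀ (by positivity)]
      calc L ^ (m - 1) * r ≤ r ^ (m - 1) * r := by
            have : 0 ≤ m - 1 := by linarith [H.one_lt]
            gcongr
        _ = r ^ m := by
            rw [← Real.rpow_add_one hr0.ne']
            congr 1
            ring
    have h4 := mul_le_mul_of_nonneg_left h3 hC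
    have h5 : 0 ≤ C * L := by positivity
    linarith

/-- A linear functional that is bounded on the unit modular ball is sequentially continuous for
the modular convergence. -/
theorem tendsto_functional (H : IsModularMap μ q m P D)
    (hf : ∀ φ, modular μ q D φ ≤ 1 → |f φ| ≤ C) {w : ℕ → V}
    (hw : Tendsto (fun n => modular μ q D (w n)) atTop (𝓝 0)) :
    Tendsto (fun n => f (w n)) atTop (𝓝 0) := by
  rw [Metric.tendsto_atTop]
  intro ε hε
  -- With this `c`, `|C| + 1 ≤ c ε`. Once `c • w n` is in the unit ball, `c |f (w n)| ≤ C < c ε`.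
  set c : ℝ := max 1 ((|C| + 1) / ε) with hc
  have hc1 : 1 ≤ c := le_max_left _ _
  have hc0 : 0 < c := by linarith
  have hcP : 0 < c ^ P := Real.rpow_pos_of_pos hc0 P
  obtain ⟨n₀, hn₀⟩ := Metric.tendsto_atTop.1 hw (c ^ P)⁻¹ (inv_pos.2 hcP)
  refine ⟨n₀, fun n hn => ?_⟩
  have h1 := hn₀ n hn
  rw [Real.dist_eq, sub_zero, abs_of_nonneg (modular_nonneg _)] at h1
  have h2 : modular μ q D (c • w n) ≤ 1 := by
    refine (H.modular_smul_le hc1 (w n)).trans ?_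
    calc c ^ P * modular μ q D (w n) ≤ c ^ P * (c ^ P)⁻¹ := by gcongr
      _ = 1 := mul_inv_cancel₀ hcP.ne'
  have h3 := hf _ h2
  rw [map_smul, smul_eq_mul, abs_mul, abs_of_pos hc0] at h3
  rw [Real.dist_eq, sub_zero]
  have h4 : (|C| + 1) ≤ c * ε := by
    have := le_max_right 1 ((|C| + 1) / ε)
    rwa [div_le_iff₀ hε] at this
  have h5 : c * |f (w n)| < c * ε := by linarith [le_abs_self C]
  exact lt_of_mul_lt_mul_left h5 hc0.le

/-- The first variation of the energy. -/
theorem hasDerivAt_energy (H : IsModularMap μ q m P D) (u φ : V) :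
    Integrable (fun z => |D u z| ^ (q z - 2) * D u z * D φ z) μ ∧
    HasDerivAt (fun t : ℝ => energy μ q D (u + t • φ))
      (∫ z, |D u z| ^ (q z - 2) * D u z * D φ z ∂μ) 0 := by
  have hum := H.measurable u
  have hφm := H.measurable φ
  have hqm := H.measurable_exponent
  have hbm : Measurable fun z => (|D u z| + |D φ z|) ^ q z := by fun_prop
  -- This function dominates the `t`-derivative of the integrand for all `|t| < 1`.
  have hbi : Integrable (fun z => (|D u z| + |D φ z|) ^ q z) μ := by
    have hi : Integrable (fun z => 2 ^ P * (|D u z| ^ q z + |D φ z| ^ q z)) μ :=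
      ((H.integrable u).add (H.integrable φ)).const_mul _
    refine hi.mono hbm.aestronglyMeasurable (Eventually.of_forall fun z => ?_)
    rw [Real.norm_of_nonneg (by positivity), Real.norm_of_nonneg (by positivity)]
    have h1 : |D u z| + |D φ z| ≤ max (2 * |D u z|) (2 * |D φ z|) := by
      rcases le_total |D u z| |D φ z| with h | h
      · exact le_max_of_le_right (by linarith)
      · exact le_max_of_le_left (by linarith)
    refine (rpow_le_add_of_le_max (by positivity) (by positivity) (by positivity)
      (by linarith [H.one_lt_exponent z]) h1).trans ?_
    rw [Real.mul_rpow two_pos.le (abs_nonneg _), Real.mul_rpow two_pos.le (abs_nonneg _),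
      ← mul_add]
    gcongr
    · norm_num
    · exact H.exponent_le z
  have hkey := hasDerivAt_integral_of_dominated_loc_of_deriv_le (μ := μ) (𝕜 := ℝ)
    (F := fun t z => |D u z + t * D φ z| ^ q z / q z)
    (F' := fun t z => |D u z + t * D φ z| ^ (q z - 2) * (D u z + t * D φ z) * D φ z)
    (x₀ := 0) (s := Metric.ball 0 1) (bound := fun z => (|D u z| + |D φ z|) ^ q z)
    (Metric.ball_mem_nhds 0 one_pos)
    (Eventually.of_forall fun t => by
      have : Measurable fun z => |D u z + t * D φ z| ^ q z / q z := by fun_prop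
      exact this.aestronglyMeasurable)
    (by simpa using H.integrable_div u)
    (by
      have : Measurable fun z =>
          |D u z + 0 * D φ z| ^ (q z - 2) * (D u z + 0 * D φ z) * D φ z := by fun_prop
      exact this.aestronglyMeasurable)
    (Eventually.of_forall fun z t ht => by
      rw [Real.norm_eq_abs]
      refine abs_rpow_sub_two_mul_mul_le (H.one_lt_exponent z) ?_ le_rfl (abs_nonneg _)
      refine (abs_add_le _ _).trans ?_
      rw [abs_mul]
      have h1 : |t| ≤ 1 := by simpa using (mem_ball_zero_iff.1 ht).le
      gcongr
      exact mul_le_of_le_one_left (abs_nonneg _) h1)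
    hbi
    (Eventually.of_forall fun z t _ =>
      hasDerivAt_abs_affine_rpow_div (H.one_lt_exponent z) (D u z) (D φ z) t)
  simp only [zero_mul, add_zero] at hkey
  refine ⟨hkey.1, hkey.2.congr_of_eventuallyEq (Eventually.of_forall fun t => ?_)⟩
  refine integral_congr_ae ?_
  filter_upwards [H.add u (t • φ), H.smul t φ] with z h1 h2
  simp only [h1, h2]

/-- Testing both equations with `u - v` and subtracting gives a nonnegative integrand with integral
zero. Strict monotonicity of `t ↦ |t| ^ (q - 2) t` then forces `D u = D v` a.e. -/
theorem eq_of_integral_eq (H : IsModularMap μ q m P D) (hinj : ∀ u, D u =ᵐ[μ] 0 → u = 0)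
    {u v : V} (huv : ∀ φ, ∫ z, |D u z| ^ (q z - 2) * D u z * D φ z ∂μ =
      ∫ z, |D v z| ^ (q z - 2) * D v z * D φ z ∂μ) : u = v := by
  have hi : ∀ w : V, Integrable (fun z => |D w z| ^ (q z - 2) * D w z * D (u - v) z) μ :=
    fun w => (H.hasDerivAt_energy w (u - v)).1
  have hmono := fun z => abs_rpow_sub_two_mul_self_strictMono (H.one_lt_exponent z)
  have h0 : ∫ z, (|D u z| ^ (q z - 2) * D u z * D (u - v) z -
      |D v z| ^ (q z - 2) * D v z * D (u - v) z) ∂μ = 0 := by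
    rw [integral_sub (hi u) (hi v), huv, sub_self]
  have hnn : 0 ≤ᵐ[μ] fun z => |D u z| ^ (q z - 2) * D u z * D (u - v) z -
      |D v z| ^ (q z - 2) * D v z * D (u - v) z := by
    filter_upwards [H.sub u v] with z hz
    rw [hz, ← sub_mul, Pi.zero_apply]
    rcases le_total (D u z) (D v z) with h | h
    · exact mul_nonneg_of_nonpos_of_nonpos (sub_nonpos.2 ((hmono z).monotone h))
        (sub_nonpos.2 h)
    · exact mul_nonneg (sub_nonneg.2 ((hmono z).monotone h)) (sub_nonneg.2 h)
  have hz := (integral_eq_zero_iff_of_nonneg_ae hnn ((hi u).sub (hi v))).1 h0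
  refine sub_eq_zero.1 (hinj _ ?_)
  filter_upwards [hz, H.sub u v] with z hz h1
  simp only [Pi.zero_apply] at hz ⊢
  rw [← sub_mul, mul_eq_zero] at hz
  rcases hz with hz | hz
  · rw [h1, (hmono z).injective (sub_eq_zero.1 hz), sub_self]
  · exact hz

/-- Existence of a minimizer of `energy - f`. -/
theorem exists_minimizer (H : IsModularMap μ q m P D)
    (hcomplete : ∀ u : ℕ → V,
      (∀ ε > 0, ∃ n₀, ∀ k ≥ n₀, ∀ l ≥ n₀, modular μ q D (u k - u l) ≤ ε) →
      ∃ w : V, ∃ ns : ℕ → ℕ, StrictMono ns ∧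
        ∀ᵐ z ∂μ, Tendsto (fun k => D (u (ns k)) z) atTop (𝓝 (D w z)))
    (hf : ∀ φ, modular μ q D φ ≤ 1 → |f φ| ≤ C) :
    ∃ w : V, ∀ v : V, energy μ q D w - f w ≤ energy μ q D v - f v := by
  have hC := H.functional_bound_nonneg hf
  set I : V → ℝ := fun v => energy μ q D v - f v with hI
  have hE0 : ∀ v, 0 ≤ energy μ q D v := fun v => integral_nonneg (H.rpow_div_nonneg v)
  -- Coercivity: `L` is taken so large that `|f v|` is at most `C L` plus half of the energy.
  obtain ⟨A, hA⟩ : ∃ A : ℝ, ∀ v, energy μ q D v ≤ 2 * (I v + A) := by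
    have hlim : Tendsto (fun L : ℝ => C * (L ^ (m - 1))⁻¹ * |P|) atTop (𝓝 0) := by
      have := (tendsto_rpow_atTop (sub_pos.2 H.one_lt)).inv_tendsto_atTop
      simpa using (this.const_mul C).mul_const |P|
    obtain ⟨L, hL, hL1⟩ := ((hlim.eventually (ge_mem_nhds one_half_pos)).and
      (eventually_ge_atTop 1)).exists
    refine ⟨C * L, fun v => ?_⟩
    have hL0 : 0 < L := by linarith
    have h1 := (le_abs_self _).trans (H.abs_functional_le hf hL1 v)
    have h2 : modular μ q D v ≤ |P| * energy μ q D v :=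
      (H.modular_le_mul_energy v).trans (mul_le_mul_of_nonneg_right (le_abs_self P) (hE0 v))
    have h3 : C * (L ^ (m - 1))⁻¹ * modular μ q D v ≤ 1 / 2 * energy μ q D v := by
      calc C * (L ^ (m - 1))⁻¹ * modular μ q D v
          ≤ C * (L ^ (m - 1))⁻¹ * (|P| * energy μ q D v) := by gcongr
        _ = C * (L ^ (m - 1))⁻¹ * |P| * energy μ q D v := by ring
        _ ≤ 1 / 2 * energy μ q D v := mul_le_mul_of_nonneg_right hL (hE0 v)
    simp only [hI]
    linarith
  have hbdd : BddBelow (range I) := ⟨-A, by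
    rintro _ ⟨v, rfl⟩
    linarith [hA v, hE0 v]⟩
  set a := ⨅ v, I v with ha
  have hle : ∀ v, a ≤ I v := fun v => ciInf_le hbdd v
  have hseq : ∀ n : ℕ, ∃ v, I v < a + 1 / ((n : ℝ) + 1) := fun n =>
    exists_lt_of_ciInf_lt (lt_add_of_pos_right a (by positivity))
  choose u hu using hseq
  have hone : ∀ n : ℕ, 1 / ((n : ℝ) + 1) ≤ 1 := fun n => by
    rw [div_le_one (by positivity)]
    linarith [n.cast_nonneg (α := ℝ)]
  set R := |P| * (2 * (a + 1 + A)) with hR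
  have hRn : ∀ n, modular μ q D (u n) ≤ R := fun n => by
    refine (H.modular_le_mul_energy _).trans
      ((mul_le_mul_of_nonneg_right (le_abs_self P) (hE0 _)).trans ?_)
    refine mul_le_mul_of_nonneg_left ?_ (abs_nonneg P)
    linarith [hA (u n), hu n, hone n]
  have hR0 : 0 ≤ R := (modular_nonneg (u 0)).trans (hRn 0)
  have hcau : ∀ ε > 0, ∃ n₀, ∀ k ≥ n₀, ∀ l ≥ n₀, modular μ q D (u k - u l) ≤ ε := by
    intro ε hε
    obtain ⟨C', hC', hle'⟩ := H.exists_modular_sub_le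
      (show 0 < ε / (4 * (R + 1)) by positivity)
    have hlim : Tendsto (fun n : ℕ => C' * (1 / ((n : ℝ) + 1))) atTop (𝓝 0) := by
      simpa using tendsto_one_div_add_atTop_nhds_zero_nat.const_mul C'
    obtain ⟨n₀, hn₀⟩ := (hlim.eventually (ge_mem_nhds (half_pos hε))).exists
    refine ⟨n₀, fun k hk l hl => (hle' _ _).trans ?_⟩
    have hdec : ∀ n : ℕ, n₀ ≤ n → I (u n) ≤ a + 1 / ((n₀ : ℝ) + 1) := fun n hn => by
      have : 1 / ((n : ℝ) + 1) ≤ 1 / ((n₀ : ℝ) + 1) := by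
        have : (n₀ : ℝ) ≤ n := by exact_mod_cast hn
        gcongr
      linarith [hu n]
    -- The linear term `f` cancels in the midpoint defect, so the defect of the energy is that of
    -- `I`, and `I` is at least `a` at the midpoint.
    have h1 : (energy μ q D (u k) + energy μ q D (u l)) / 2 -
        energy μ q D ((1 / 2 : ℝ) • (u k + u l)) ≤ 1 / ((n₀ : ℝ) + 1) := by
      have e1 := hdec k hk
      have e2 := hdec l hl
      have e3 := hle ((1 / 2 : ℝ) • (u k + u l))
      simp only [hI, map_smul, map_add, smul_eq_mul] at e1 e2 e3
      linarith
    have h2 : ε / (4 * (R + 1)) * (modular μ q D (u k) + modular μ q D (u l)) ≤ ε / 2 := by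
      calc ε / (4 * (R + 1)) * (modular μ q D (u k) + modular μ q D (u l))
          ≤ ε / (4 * (R + 1)) * (2 * (R + 1)) := by
            gcongr
            linarith [hRn k, hRn l]
        _ = ε / 2 := by
            field_simp
            norm_num
    have h3 := mul_le_mul_of_nonneg_left h1 hC'
    linarith
  obtain ⟨w, ns, hns, hw⟩ := hcomplete u hcau
  -- Fatou's lemma in the second index of the Cauchy condition: pointwise convergence of `D` along
  -- the subsequence is upgraded to modular convergence, which `f` respects.
  have hmod : Tendsto (fun k => modular μ q D (u (ns k) - w)) atTop (𝓝 0) := by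
    rw [Metric.tendsto_atTop]
    intro ε hε
    obtain ⟨n₀, hn₀⟩ := hcau (ε / 2) (half_pos hε)
    refine ⟨n₀, fun k hk => ?_⟩
    rw [Real.dist_eq, sub_zero, abs_of_nonneg (modular_nonneg _)]
    refine lt_of_le_of_lt ?_ (half_lt_self hε)
    refine (integrable_and_integral_le_of_ae_tendsto
      (g := fun l z => |D (u (ns k) - u (ns l)) z| ^ q z)
      (fun l => H.measurable_rpow _) (fun l z => Real.rpow_nonneg (abs_nonneg _) _)
      (fun l => H.integrable _) ?_ ?_).2
    · filter_upwards [eventually_ge_atTop n₀] with l hl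
      exact hn₀ _ (hk.trans hns.le_apply) _ (hl.trans hns.le_apply)
    · filter_upwards [hw, H.sub (u (ns k)) w,
        ae_all_iff.2 fun l => H.sub (u (ns k)) (u (ns l))] with z h1 h2 h3
      simp only [h2, h3]
      exact ((h1.const_sub _).abs).rpow_const
        (Or.inr (zero_lt_one.trans (H.one_lt_exponent z)).le)
  have hfw : Tendsto (fun k => f (u (ns k))) atTop (𝓝 (f w)) := by
    have := (H.tendsto_functional hf hmod).add_const (f w)
    simpa using this
  have hIw : I w ≤ a := by
    refine le_of_forall_pos_le_add fun δ hδ => ?_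
    have hlim : Tendsto (fun k => a + 1 / ((ns k : ℝ) + 1) + f (u (ns k))) atTop
        (𝓝 (a + 0 + f w)) :=
      ((tendsto_one_div_add_atTop_nhds_zero_nat.comp hns.tendsto_atTop).const_add a).add hfw
    have hE : energy μ q D w ≤ a + δ + f w := by
      refine (integrable_and_integral_le_of_ae_tendsto
        (g := fun k z => |D (u (ns k)) z| ^ q z / q z)
        (fun k => H.measurable_rpow_div _) (fun k => H.rpow_div_nonneg _)
        (fun k => H.integrable_div _) ?_ ?_).2
      · filter_upwards [hlim.eventually (ge_mem_nhds
          (show a + 0 + f w < a + δ + f w by linarith))] with k hk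
        have := hu (ns k)
        simp only [hI] at this
        exact (by linarith : energy μ q D (u (ns k)) ≤ a + δ + f w)
      · filter_upwards [hw] with z hz
        exact (hz.abs.rpow_const
          (Or.inr (zero_lt_one.trans (H.one_lt_exponent z)).le)).div_const _
    simp only [hI]
    linarith
  exact ⟨w, fun v => hIw.trans (hle v)⟩

/-- Unique solvability of the Euler-Lagrange equation of `energy - f`. -/
theorem existsUnique_integral_eq (H : IsModularMap μ q m P D)
    (hinj : ∀ u, D u =ᵐ[μ] 0 → u = 0)
    (hcomplete : ∀ u : ℕ → V,
      (∀ ε > 0, ∃ n₀, ∀ k ≥ n₀, ∀ l ≥ n₀, modular μ q D (u k - u l) ≤ ε) →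
      ∃ w : V, ∃ ns : ℕ → ℕ, StrictMono ns ∧
        ∀ᵐ z ∂μ, Tendsto (fun k => D (u (ns k)) z) atTop (𝓝 (D w z)))
    (hf : ∀ φ, modular μ q D φ ≤ 1 → |f φ| ≤ C) :
    ∃! u : V, ∀ φ : V, Integrable (fun z => |D u z| ^ (q z - 2) * D u z * D φ z) μ ∧
      ∫ z, |D u z| ^ (q z - 2) * D u z * D φ z ∂μ = f φ := by
  obtain ⟨w, hw⟩ := H.exists_minimizer hcomplete hf
  have hEL : ∀ φ : V, Integrable (fun z => |D w z| ^ (q z - 2) * D w z * D φ z) μ ∧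
      ∫ z, |D w z| ^ (q z - 2) * D w z * D φ z ∂μ = f φ := fun φ => by
    obtain ⟨h1, h2⟩ := H.hasDerivAt_energy w φ
    refine ⟨h1, ?_⟩
    have hd := h2.sub ((hasDerivAt_id (0 : ℝ)).mul_const (f φ))
    -- `w` minimizes `energy - f` on every line through it, so the derivative there vanishes.
    have hmin : IsLocalMin ((fun t : ℝ => energy μ q D (w + t • φ)) -
        fun t => id t * f φ) 0 := by
      refine Eventually.of_forall fun t => ?_
      have := hw (w + t • φ)
      simp only [map_add, map_smul, smul_eq_mul] at this
      simp only [Pi.sub_apply, id, zero_smul, add_zero, zero_mul]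
      linarith
    have := hmin.hasDerivAt_eq_zero hd
    linarith
  exact ⟨w, hEL, fun v hv => H.eq_of_integral_eq hinj fun φ => (hv φ).2.trans (hEL φ).2.symm⟩

end IsModularMap

end Variational

end NonlocalDirichlet

namespace NonlocalDirichlet

/-! ### Poincaré inequality for functions vanishing outside `Ω`. -/

section Poincare

variable {N : ℕ} {s : ℝ} {Ω : Set (Eucl N)} {p K : Eucl N → Eucl N → ℝ}

/-- `|u(x) - u(y)| ^ p(x,y) K(x,y)` at `z = (x, y)`. -/
noncomputable def gagliardoDensity (p K : Eucl N → Eucl N → ℝ) (u : Eucl N → ℝ) (z : Eucl N × Eucl N) : ℝ :=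
  |u z.1 - u z.2| ^ p z.1 z.2 * K z.1 z.2

theorem gagliardoDensity_nonneg (hK : IsKernel s Ω p K) (u : Eucl N → ℝ)
    (z : Eucl N × Eucl N) : 0 ≤ gagliardoDensity p K u z :=
  mul_nonneg (Real.rpow_nonneg (abs_nonneg _) _) (hK.pos _ _).le

theorem measurable_gagliardoDensity (hp : IsVariableExponent Ω p) (hK : IsKernel s Ω p K)
    {u : Eucl N → ℝ} (hu : Measurable u) : Measurable (gagliardoDensity p K u) := by
  have h1 := hp.continuous.measurable
  have h2 := hK.measurable
  unfold gagliardoDensity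
  fun_prop

theorem IsVariableExponent.exists_le (hp : IsVariableExponent Ω p) :
    ∃ P : ℝ, 1 < P ∧ ∀ x y, p x y ≤ P := by
  obtain ⟨P, hP⟩ := hp.bddAbove
  have h : ∀ x y, p x y ≤ P := fun x y => hP ⟨(x, y), rfl⟩
  exact ⟨P, (hp.one_lt 0 0).trans_le (h 0 0), h⟩

/-- The only role of the condition `s p⁺ < N`. In dimension `0` the space is a single point, all
increments vanish, and uniqueness may fail. -/
theorem dimension_pos (hs0 : 0 < s) (hp : IsVariableExponent Ω p) (hsp : s * pPlus Ω p < N) :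
    0 < N := by
  have h : 0 ≤ pPlus Ω p := Real.sSup_nonneg (by
    rintro _ ⟨z, _, rfl⟩
    exact (zero_lt_one.trans (hp.one_lt _ _)).le)
  exact_mod_cast (mul_nonneg hs0.le h).trans_lt hsp

theorem le_one_add_rpow {t q : ℝ} (ht : 0 ≤ t) (hq : 1 ≤ q) : t ≤ 1 + t ^ q := by
  rcases le_total t 1 with h | h
  · exact h.trans (le_add_of_nonneg_right (Real.rpow_nonneg ht q))
  · have := Real.rpow_le_rpow_of_exponent_le h hq
    rw [Real.rpow_one] at this
    linarith

/-- Functions that vanish outside `Ω` and have bounded Gagliardo modular are bounded in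
`L^1(Ω)`. -/
theorem exists_lintegral_abs_le (hs0 : 0 < s) (hs1 : s < 1) (hN : 0 < N)
    (hΩb : Bornology.IsBounded Ω) (hp : IsVariableExponent Ω p) (hK : IsKernel s Ω p K) :
    ∃ C : ℝ, 0 ≤ C ∧ ∀ u : Eucl N → ℝ, Measurable u → (∀ᵐ x, x ∉ Ω → u x = 0) →
      ∫⁻ z, ENNReal.ofReal (gagliardoDensity p K u z) ≤ 1 →
      ∫⁻ x, ENNReal.ofReal |u x| ≤ ENNReal.ofReal C := by
  have : Nonempty (Fin N) := ⟨⟨0, hN⟩⟩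
  obtain ⟨P, hP1, hP⟩ := hp.exists_le
  obtain ⟨k₀, hk₀, hKlow⟩ := hK.lower_bound
  obtain ⟨R, hR, hΩR⟩ : ∃ R : ℝ, 0 < R ∧ Ω ⊆ Metric.ball 0 R := by
    obtain ⟨R, hR⟩ := hΩb.subset_ball (0 : Eucl N)
    exact ⟨max R 1, by positivity, hR.trans (Metric.ball_subset_ball (le_max_left _ _))⟩
  -- The unit ball `E` around `c` is disjoint from the ball `B ⊇ Ω`, so `u = 0` a.e. on `E`, and for
  -- `x ∈ B`, `y ∈ E` the density is a.e. `|u x| ^ p(x,y) K(x,y)`. Points of `B` and `E` are at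
  -- distance at most `2 R + 2`; since `s < 1` and `p ≤ P`, this bounds `K` below by `κ`.
  obtain ⟨c, hc⟩ : ∃ c : Eucl N, ‖c‖ = R + 1 :=
    ⟨EuclideanSpace.single ⟨0, hN⟩ (R + 1), by
      rw [PiLp.norm_single, Real.norm_of_nonneg (by linarith)]⟩
  set B : Set (Eucl N) := Metric.ball 0 R with hB
  set E : Set (Eucl N) := Metric.ball c 1 with hE
  set d : ℝ := 2 * R + 2 with hd
  set κ : ℝ := k₀ * d ^ (-((N : ℝ) + P)) with hκ
  have hd1 : 1 ≤ d := by linarith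
  have hκ0 : 0 < κ := by positivity
  have hEn : ∀ y ∈ E, R < ‖y‖ ∧ ‖y‖ < R + 2 := fun y hy => by
    rw [hE, mem_ball_iff_norm] at hy
    have h1 := norm_sub_norm_le c y
    have h2 := norm_sub_norm_le y c
    rw [norm_sub_rev] at h1
    constructor <;> linarith
  have hEΩ : ∀ y ∈ E, y ∉ Ω := fun y hy hyΩ => by
    have := mem_ball_zero_iff.1 (hΩR hyΩ)
    linarith [(hEn y hy).1]
  have hKκ : ∀ x ∈ B, ∀ y ∈ E, κ ≤ K x y := fun x hx y hy => by
    have hx' := mem_ball_zero_iff.1 hx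
    have hne : x ≠ y := by
      rintro rfl
      linarith [(hEn x hy).1]
    have hpos : 0 < ‖x - y‖ := norm_pos_iff.2 (sub_ne_zero.2 hne)
    have hle : ‖x - y‖ ≤ d := by
      have := norm_sub_le x y
      linarith [(hEn y hy).2]
    have hpp : 0 < p x y := zero_lt_one.trans (hp.one_lt x y)
    refine le_trans ?_ (hKlow x y hne)
    have h1 : d ^ (-((N : ℝ) + P)) ≤ d ^ (-((N : ℝ) + s * p x y)) := by
      refine Real.rpow_le_rpow_of_exponent_le hd1 ?_
      nlinarith [hP x y]
    have h2 : d ^ (-((N : ℝ) + s * p x y)) ≤ ‖x - y‖ ^ (-((N : ℝ) + s * p x y)) :=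
      Real.rpow_le_rpow_of_nonpos hpos hle (by
        have : (0 : ℝ) ≤ N := N.cast_nonneg
        nlinarith)
    exact mul_le_mul_of_nonneg_left (h1.trans h2) hk₀.le
  have hE0 : volume E ≠ 0 := (Metric.measure_ball_pos volume c one_pos).ne'
  have hEt : volume E ≠ ⊤ := measure_ball_lt_top.ne
  have hBt : volume B ≠ ⊤ := measure_ball_lt_top.ne
  set A : ENNReal := (volume B * volume E + ENNReal.ofReal κ⁻¹) / volume E with hA
  have hAt : A ≠ ⊤ := ENNReal.div_ne_top
    (ENNReal.add_ne_top.2 ⟨ENNReal.mul_ne_top hBt hEt, ENNReal.ofReal_ne_top⟩) hE0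
  refine ⟨A.toReal, ENNReal.toReal_nonneg, fun u hu hu0 hle => ?_⟩
  rw [ENNReal.ofReal_toReal hAt, hA,
    ENNReal.le_div_iff_mul_le (Or.inl hE0) (Or.inl hEt)]
  have hum : Measurable fun x => ENNReal.ofReal |u x| := by fun_prop
  have hsupp : ∫⁻ x, ENNReal.ofReal |u x| = ∫⁻ x in B, ENNReal.ofReal |u x| := by
    rw [← lintegral_indicator Metric.isOpen_ball.measurableSet]
    refine lintegral_congr_ae ?_
    filter_upwards [hu0] with x hx
    by_cases hxB : x ∈ B
    · rw [indicator_of_mem hxB]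
    · rw [indicator_of_notMem hxB, hx fun h => hxB (hΩR h)]
      simp
  have hum2 : ∀ᵐ z : Eucl N × Eucl N, z.2 ∉ Ω → u z.2 = 0 :=
    Measure.quasiMeasurePreserving_snd.ae hu0
  calc (∫⁻ x, ENNReal.ofReal |u x|) * volume E
      = ∫⁻ z in B ×ˢ E, ENNReal.ofReal |u z.1| := by
        rw [hsupp, Measure.volume_eq_prod, ← Measure.prod_restrict,
          lintegral_prod _ (by fun_prop)]
        simp only [lintegral_const, Measure.restrict_apply_univ]
        rw [lintegral_mul_const _ hum]
    _ ≤ ∫⁻ z in B ×ˢ E, (1 + ENNReal.ofReal κ⁻¹ *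
          ENNReal.ofReal (gagliardoDensity p K u z)) := by
        refine setLIntegral_mono_ae' (Metric.isOpen_ball.measurableSet.prod
          Metric.isOpen_ball.measurableSet) ?_
        filter_upwards [hum2] with z hz hzm
        rw [← ENNReal.ofReal_one, ← ENNReal.ofReal_mul (by positivity),
          ← ENNReal.ofReal_add zero_le_one
            (mul_nonneg (by positivity) (gagliardoDensity_nonneg hK u z))]
        refine ENNReal.ofReal_le_ofReal ?_
        refine (le_one_add_rpow (abs_nonneg (u z.1)) (hp.one_lt z.1 z.2).le).trans ?_
        gcongr
        rw [gagliardoDensity, hz (hEΩ _ hzm.2), sub_zero, le_inv_mul_iff₀ hκ0, mul_comm]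
        gcongr
        exact hKκ _ hzm.1 _ hzm.2
    _ = volume B * volume E + ENNReal.ofReal κ⁻¹ *
          ∫⁻ z in B ×ˢ E, ENNReal.ofReal (gagliardoDensity p K u z) := by
        rw [lintegral_add_left measurable_const, lintegral_const_mul' _ _ ENNReal.ofReal_ne_top,
          setLIntegral_one, Measure.volume_eq_prod, Measure.prod_prod]
    _ ≤ volume B * volume E + ENNReal.ofReal κ⁻¹ * 1 := by
        gcongr
        exact (setLIntegral_le_lintegral _ _).trans hle
    _ = _ := by rw [mul_one]

/-- If `s`-Hölder averages of `u` near `x` are controlled by `g` and the `L^1` norm of `u` is at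
most `M`, then `|u x| ^ p(x,x) ≤ C (1 + g)`. The constant does not depend on `x`. -/
theorem rpow_abs_le_of_lintegral_le (hs0 : 0 < s) (hN : 0 < N)
    (hp : IsVariableExponent Ω p) (hK : IsKernel s Ω p K) {P k₀ t₀ M ω : ℝ}
    (hP : ∀ x y, p x y ≤ P) (hk₀ : 0 < k₀)
    (hKlow : ∀ x y, x ≠ y → k₀ * ‖x - y‖ ^ (-((N : ℝ) + s * p x y)) ≤ K x y)
    (ht₀ : 0 < t₀) (ht₁ : t₀ ≤ 1) (hM : 0 ≤ M) (hω : 0 < ω)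
    (hball : volume (Metric.ball (0 : Eucl N) 1) = ENNReal.ofReal ω)
    {u : Eucl N → ℝ} (hu : Measurable u) (huM : ∫⁻ y, ENNReal.ofReal |u y| ≤ ENNReal.ofReal M)
    {x : Eucl N} (hx : ∀ y, ‖y - x‖ < t₀ → p x x - s / (N * P) ≤ p x y)
    {g : ℝ} (hg : 0 ≤ g)
    (hug : ∫⁻ y, ENNReal.ofReal (gagliardoDensity p K u (x, y)) ≤ ENNReal.ofReal g) :
    |u x| ^ p x x ≤ (1 + M / (ω * t₀ ^ N) + 1 / (k₀ * ω)) ^ P * (1 + g) := by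
  have hN' : (0 : ℝ) < N := by exact_mod_cast hN
  have hpx := hp.one_lt x x
  have hpx0 : 0 < p x x := by linarith
  have hP0 : 0 < P := by linarith [hP x x]
  -- `S` is the size to be proved for `|u x|`, up to a constant, and `t` is the radius of the
  -- averaging ball. The exponent `η` makes `t ^ (-N)` cost only the factor `T ^ (1 / P) ≤ S`, while
  -- `t ^ (s r)` still gains at least `T ^ (-η s)`, which covers a drop of the exponent by `η s = s
  -- / (N P)`.
  set η : ℝ := 1 / (N * P) with hη
  have hη0 : 0 < η := by positivity
  set T : ℝ := 1 + g with hT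
  have hT1 : 1 ≤ T := by linarith
  have hT0 : 0 < T := by linarith
  set S : ℝ := T ^ (1 / p x x) with hS
  have hS1 : 1 ≤ S := Real.one_le_rpow hT1 (by positivity)
  have hS0 : 0 < S := by linarith
  set t : ℝ := t₀ * T ^ (-η) with ht
  have hTη : T ^ (-η) ≤ 1 := Real.rpow_le_one_of_one_le_of_nonpos hT1 (by linarith)
  have ht0 : 0 < t := by positivity
  have htle : t ≤ t₀ := mul_le_of_le_one_right ht₀.le hTη
  have htT : t ≤ T ^ (-η) := mul_le_of_le_one_left (by positivity) ht₁
  have hpt : ∀ y ∈ Metric.ball x t, |u x| ≤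
      S + |u y| + S * t ^ N * T⁻¹ / k₀ * gagliardoDensity p K u (x, y) := fun y hy => by
    have hxy : ‖y - x‖ < t := mem_ball_iff_norm.1 hy
    have hq := hx y (hxy.trans_le htle)
    have hq1 := hp.one_lt x y
    set r := p x y with hr
    have hr0 : 0 < r := by linarith
    set Δ := |u x - u y| with hΔ
    have hΔ0 : 0 ≤ Δ := abs_nonneg _
    have h1 : |u x| ≤ Δ + |u y| := by
      have := abs_add_le (u x - u y) (u y)
      rwa [sub_add_cancel] at this
    have h2 : Δ ≤ S + S * (Δ / S) ^ r := by
      have := mul_le_mul_of_nonneg_left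
        (le_one_add_rpow (div_nonneg hΔ0 hS0.le) hq1.le) hS0.le
      rwa [mul_div_cancel₀ _ hS0.ne', mul_add, mul_one] at this
    have h3 : (Δ / S) ^ r ≤ t ^ N * T⁻¹ / k₀ * gagliardoDensity p K u (x, y) := by
      rcases eq_or_ne x y with hxy' | hxy'
      · have : Δ = 0 := by rw [hΔ, hxy', sub_self, abs_zero]
        rw [this, zero_div, Real.zero_rpow hr0.ne']
        have := gagliardoDensity_nonneg hK u (x, y)
        positivity
      · have hpos : 0 < ‖x - y‖ := norm_pos_iff.2 (sub_ne_zero.2 hxy')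
        have hKt : k₀ * t ^ (-((N : ℝ) + s * r)) ≤ K x y := by
          refine le_trans ?_ (hKlow x y hxy')
          refine mul_le_mul_of_nonneg_left ?_ hk₀.le
          refine Real.rpow_le_rpow_of_nonpos hpos ?_ ?_
          · rw [norm_sub_rev]
            exact hxy.le
          · have : 0 < s * r := by positivity
            linarith
        have htr : t ^ ((N : ℝ) + s * r) = t ^ N * t ^ (s * r) := by
          rw [Real.rpow_add ht0, Real.rpow_natCast]
        have hK2 : 1 ≤ t ^ N * t ^ (s * r) / k₀ * K x y := by
          rw [Real.rpow_neg ht0.le, htr] at hKt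
          have h := mul_le_mul_of_nonneg_left hKt
            (show 0 ≤ t ^ N * t ^ (s * r) / k₀ by positivity)
          refine le_trans (le_of_eq ?_) h
          have : t ^ N * t ^ (s * r) ≠ 0 := by positivity
          field_simp
        -- In powers of `T` this reads `η s r + r / p(x,x) ≥ 1`. It holds because `r ≥ p(x,x) - η
        -- s`, `p(x,x) > 1` and `r > 1`.
        have hST : t ^ (s * r) / S ^ r ≤ T⁻¹ := by
          have e1 : t ^ (s * r) ≤ T ^ (-η * (s * r)) := by
            rw [Real.rpow_mul hT0.le]
            gcongr
          have e2 : S ^ r = T ^ (1 / p x x * r) := by rw [hS, ← Real.rpow_mul hT0.le]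
          rw [e2, div_le_iff₀ (by positivity), ← Real.rpow_neg_one, ← Real.rpow_add hT0]
          refine e1.trans (Real.rpow_le_rpow_of_exponent_le hT1 ?_)
          have e3 : s / (N * P) = η * s := by rw [hη]; ring
          rw [e3] at hq
          have e4 : 1 - η * s ≤ 1 / p x x * r := by
            rw [one_div, le_inv_mul_iff₀ hpx0]
            have : 0 < η * s := by positivity
            nlinarith
          have : η * s ≤ η * s * r := le_mul_of_one_le_right (by positivity) hq1.le
          linarith
        have hΔr : 0 ≤ Δ ^ r := Real.rpow_nonneg hΔ0 r
        have hKp := hK.pos x y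
        rw [Real.div_rpow hΔ0 hS0.le]
        calc Δ ^ r / S ^ r ≤ Δ ^ r / S ^ r * (t ^ N * t ^ (s * r) / k₀ * K x y) :=
              le_mul_of_one_le_right (by positivity) hK2
          _ = t ^ N * (t ^ (s * r) / S ^ r) / k₀ * (Δ ^ r * K x y) := by ring
          _ ≤ t ^ N * T⁻¹ / k₀ * (Δ ^ r * K x y) := by gcongr
    have h4 := mul_le_mul_of_nonneg_left h3 hS0.le
    have e : S * (t ^ N * T⁻¹ / k₀ * gagliardoDensity p K u (x, y)) =
      S * t ^ N * T⁻¹ / k₀ * gagliardoDensity p K u (x, y) := by ring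
    linarith
  set c : ℝ := S * t ^ N * T⁻¹ / k₀ with hc
  have hc0 : 0 ≤ c := by positivity
  have hvol : volume (Metric.ball x t) = ENNReal.ofReal (t ^ N * ω) := by
    have : Nonempty (Fin N) := ⟨⟨0, hN⟩⟩
    rw [Measure.addHaar_ball _ _ ht0.le, hball, finrank_euclideanSpace_fin,
      ENNReal.ofReal_mul (by positivity)]
  -- The pointwise bound is integrated over the ball of radius `t` around `x`.
  have hint : |u x| * (t ^ N * ω) ≤ S * (t ^ N * ω) + M + c * g := by
    rw [← ENNReal.ofReal_le_ofReal_iff (by positivity), ENNReal.ofReal_mul (abs_nonneg _),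
      ENNReal.ofReal_add (by positivity) (by positivity),
      ENNReal.ofReal_add (by positivity) hM, ENNReal.ofReal_mul hS0.le, ENNReal.ofReal_mul hc0,
      ← hvol]
    have hdm := measurable_gagliardoDensity hp hK hu
    calc ENNReal.ofReal |u x| * volume (Metric.ball x t)
        = ∫⁻ _ in Metric.ball x t, ENNReal.ofReal |u x| := by rw [setLIntegral_const]
      _ ≤ ∫⁻ y in Metric.ball x t, (ENNReal.ofReal S + ENNReal.ofReal |u y| +
            ENNReal.ofReal c * ENNReal.ofReal (gagliardoDensity p K u (x, y))) := by
          refine setLIntegral_mono' Metric.isOpen_ball.measurableSet fun y hy => ?_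
          rw [← ENNReal.ofReal_mul hc0, ← ENNReal.ofReal_add hS0.le (abs_nonneg _),
            ← ENNReal.ofReal_add (by positivity)
              (mul_nonneg hc0 (gagliardoDensity_nonneg hK u _))]
          exact ENNReal.ofReal_le_ofReal (hpt y hy)
      _ = ENNReal.ofReal S * volume (Metric.ball x t) +
            (∫⁻ y in Metric.ball x t, ENNReal.ofReal |u y|) + ENNReal.ofReal c *
              ∫⁻ y in Metric.ball x t, ENNReal.ofReal (gagliardoDensity p K u (x, y)) := by
          rw [lintegral_add_left (by fun_prop), lintegral_add_left measurable_const,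
            setLIntegral_const, lintegral_const_mul' _ _ ENNReal.ofReal_ne_top]
      _ ≤ _ := by
          gcongr
          · exact (setLIntegral_le_lintegral _ _).trans huM
          · exact (setLIntegral_le_lintegral _ _).trans hug
  have hcg : c * g ≤ S * t ^ N / k₀ := by
    have : T⁻¹ * g ≤ 1 := by
      rw [inv_mul_le_iff₀ hT0]
      linarith
    calc c * g = S * t ^ N / k₀ * (T⁻¹ * g) := by rw [hc]; ring
      _ ≤ S * t ^ N / k₀ * 1 := by gcongr
      _ = _ := mul_one _
  have htN : (t ^ N)⁻¹ ≤ (t₀ ^ N)⁻¹ * S := by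
    have e1 : (T ^ (-η)) ^ N = T ^ (-(1 / P)) := by
      rw [← Real.rpow_natCast, ← Real.rpow_mul hT0.le]
      congr 1
      rw [hη]
      field_simp
    rw [ht, mul_pow, mul_inv, e1, Real.rpow_neg hT0.le, inv_inv]
    gcongr
    exact Real.rpow_le_rpow_of_exponent_le hT1 (one_div_le_one_div_of_le hpx0 (hP x x))
  set C₁ : ℝ := 1 + M / (ω * t₀ ^ N) + 1 / (k₀ * ω) with hC₁
  have hC₁1 : 1 ≤ C₁ := by
    have h1 : 0 ≤ M / (ω * t₀ ^ N) := by positivity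
    have h2 : 0 ≤ 1 / (k₀ * ω) := by positivity
    linarith
  have hux : |u x| ≤ C₁ * S := by
    have h1 : |u x| ≤ (S * (t ^ N * ω) + M + S * t ^ N / k₀) / (t ^ N * ω) := by
      rw [le_div_iff₀ (by positivity)]
      linarith
    have h2 : (S * (t ^ N * ω) + M + S * t ^ N / k₀) / (t ^ N * ω) =
        S + M / ω * (t ^ N)⁻¹ + S * (1 / (k₀ * ω)) := by
      field_simp
    have h3 : M / ω * (t ^ N)⁻¹ ≤ M / ω * ((t₀ ^ N)⁻¹ * S) := by gcongr
    have h4 : M / ω * ((t₀ ^ N)⁻¹ * S) = M / (ω * t₀ ^ N) * S := by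
      field_simp
    rw [hC₁]
    linarith
  calc |u x| ^ p x x ≤ (C₁ * S) ^ p x x := by gcongr
    _ = C₁ ^ p x x * T := by
      rw [Real.mul_rpow (by positivity) hS0.le, hS, ← Real.rpow_mul hT0.le,
        one_div_mul_cancel hpx0.ne', Real.rpow_one]
    _ ≤ C₁ ^ P * T := by
      gcongr
      exact hP x x

/-- The Poincaré inequality for functions that vanish outside `Ω`. -/
theorem exists_lebesgueModular_le (hs0 : 0 < s) (hs1 : s < 1) (hN : 0 < N)
    (hΩo : IsOpen Ω) (hΩb : Bornology.IsBounded Ω) (hp : IsVariableExponent Ω p)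
    (hK : IsKernel s Ω p K) :
    ∃ C : ℝ, 0 ≤ C ∧ ∀ u : Eucl N → ℝ, Measurable u → (∀ᵐ x, x ∉ Ω → u x = 0) →
      ∫⁻ z, ENNReal.ofReal (gagliardoDensity p K u z) ≤ 1 →
      lebesgueModular Ω p u 1 ≤ ENNReal.ofReal C := by
  obtain ⟨M, hM, hMu⟩ := exists_lintegral_abs_le hs0 hs1 hN hΩb hp hK
  obtain ⟨P, hP1, hP⟩ := hp.exists_le
  obtain ⟨k₀, hk₀, hKlow⟩ := hK.lower_bound
  obtain ⟨R, hR⟩ := hΩb.subset_ball (0 : Eucl N)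
  have hN' : (0 : ℝ) < N := by exact_mod_cast hN
  have hε : 0 < s / (N * P) := by
    have : 0 < P := by linarith
    positivity
  -- The radius `R + 1` leaves room for all points at distance less than `1` from `Ω`.
  have hunif := ((isCompact_closedBall (0 : Eucl N) (R + 1)).prod
    (isCompact_closedBall (0 : Eucl N) (R + 1))).uniformContinuousOn_of_continuous
    hp.continuous.continuousOn
  obtain ⟨δ, hδ, hpδ⟩ := Metric.uniformContinuousOn_iff.1 hunif _ hε
  have hxy : ∀ x ∈ Ω, ∀ y, ‖y - x‖ < min δ 1 → p x x - s / (N * P) ≤ p x y := by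
    intro x hx y hy
    have hx1 := mem_ball_zero_iff.1 (hR hx)
    have hy1 : ‖y‖ ≤ R + 1 := by
      have := norm_sub_norm_le y x
      linarith [hy.trans_le (min_le_right _ _)]
    have hxm : x ∈ Metric.closedBall (0 : Eucl N) (R + 1) :=
      mem_closedBall_zero_iff.2 (by linarith)
    have hym : y ∈ Metric.closedBall (0 : Eucl N) (R + 1) := mem_closedBall_zero_iff.2 hy1
    have h := hpδ (x, y) ⟨hxm, hym⟩ (x, x) ⟨hxm, hxm⟩ (by
      rw [Prod.dist_eq, dist_self, dist_eq_norm]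
      exact max_lt hδ (hy.trans_le (min_le_left _ _)))
    rw [Real.dist_eq] at h
    linarith [(abs_lt.1 h).1]
  set ω : ℝ := (volume (Metric.ball (0 : Eucl N) 1)).toReal with hω
  have hbt : volume (Metric.ball (0 : Eucl N) 1) ≠ ⊤ := measure_ball_lt_top.ne
  have hω0 : 0 < ω :=
    ENNReal.toReal_pos (Metric.measure_ball_pos volume _ one_pos).ne' hbt
  set C₁ : ℝ := (1 + M / (ω * min δ 1 ^ N) + 1 / (k₀ * ω)) ^ P with hC₁
  have hδ1 : 0 < min δ 1 := lt_min hδ one_pos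
  have hC₁0 : 0 < C₁ := by positivity
  have hΩt : volume Ω ≠ ⊤ := hΩb.measure_lt_top.ne
  set A : ENNReal := ENNReal.ofReal C₁ * (volume Ω + 1) with hA
  have hAt : A ≠ ⊤ := ENNReal.mul_ne_top ENNReal.ofReal_ne_top
    (ENNReal.add_ne_top.2 ⟨hΩt, ENNReal.one_ne_top⟩)
  refine ⟨A.toReal, ENNReal.toReal_nonneg, fun u hu hu0 hle => ?_⟩
  rw [ENNReal.ofReal_toReal hAt]
  have hdm := measurable_gagliardoDensity hp hK hu
  set G : Eucl N → ENNReal := fun x => ∫⁻ y, ENNReal.ofReal (gagliardoDensity p K u (x, y))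
    with hG
  calc lebesgueModular Ω p u 1
      ≤ ∫⁻ x in Ω, ENNReal.ofReal C₁ * (1 + G x) := by
        refine setLIntegral_mono' hΩo.measurableSet fun x hx => ?_
        rcases eq_or_ne (G x) ⊤ with h | h
        · rw [h, add_top, ENNReal.mul_top (ENNReal.ofReal_pos.2 hC₁0).ne']
          exact le_top
        · rw [← ENNReal.ofReal_toReal h, ← ENNReal.ofReal_one,
            ← ENNReal.ofReal_add zero_le_one ENNReal.toReal_nonneg,
            ← ENNReal.ofReal_mul hC₁0.le, div_one]
          refine ENNReal.ofReal_le_ofReal ?_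
          exact rpow_abs_le_of_lintegral_le hs0 hN hp hK hP hk₀ hKlow hδ1 (min_le_right _ _) hM
            hω0 (ENNReal.ofReal_toReal hbt).symm hu (hMu u hu hu0 hle) (hxy x hx)
            ENNReal.toReal_nonneg (ENNReal.ofReal_toReal h).ge
    _ = ENNReal.ofReal C₁ * (volume Ω + ∫⁻ x in Ω, G x) := by
        rw [lintegral_const_mul' _ _ ENNReal.ofReal_ne_top, lintegral_add_left measurable_const,
          setLIntegral_one]
    _ ≤ ENNReal.ofReal C₁ * (volume Ω + 1) := by
        gcongr
        refine (setLIntegral_le_lintegral _ _).trans (le_trans (le_of_eq ?_) hle)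
        rw [Measure.volume_eq_prod, lintegral_prod _ (by fun_prop)]

end Poincare

end NonlocalDirichlet

namespace NonlocalDirichlet

/-! ### The increment map on `X₀` satisfies the abstract hypotheses. -/

section Solvability

open Filter Topology

variable {N : ℕ} {s : ℝ} {Ω : Set (Eucl N)} {p K : Eucl N → Eucl N → ℝ}

theorem measurableSet_Q (hΩo : IsOpen Ω) : MeasurableSet (Q Ω) :=
  (hΩo.measurableSet.compl.prod hΩo.measurableSet.compl).compl

/-- For functions vanishing outside `Ω`, integrating over `Q` or over the whole space is the
same. -/
theorem lintegral_gagliardoDensity_eq (hΩo : IsOpen Ω) (hp : IsVariableExponent Ω p)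
    {u : Eucl N → ℝ} (hu0 : ∀ᵐ x, x ∉ Ω → u x = 0) :
    ∫⁻ z, ENNReal.ofReal (gagliardoDensity p K u z) = gagliardoModular Ω p K u 1 := by
  rw [gagliardoModular, ← lintegral_indicator (measurableSet_Q hΩo)]
  refine lintegral_congr_ae ?_
  have h1 : ∀ᵐ z : Eucl N × Eucl N, z.1 ∉ Ω → u z.1 = 0 :=
    Measure.quasiMeasurePreserving_fst.ae hu0
  have h2 : ∀ᵐ z : Eucl N × Eucl N, z.2 ∉ Ω → u z.2 = 0 :=
    Measure.quasiMeasurePreserving_snd.ae hu0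
  filter_upwards [h1, h2] with z hz1 hz2
  by_cases hz : z ∈ Q Ω
  · rw [indicator_of_mem hz, Real.one_rpow, div_one, gagliardoDensity]
  · rw [indicator_of_notMem hz]
    have hz' : z.1 ∉ Ω ∧ z.2 ∉ Ω := by simpa [Q] using hz
    rw [gagliardoDensity, hz1 hz'.1, hz2 hz'.2, sub_zero, abs_zero,
      Real.zero_rpow (zero_lt_one.trans (hp.one_lt _ _)).ne', zero_mul, ENNReal.ofReal_zero]

theorem lintegral_gagliardoDensity_lt_top (hΩo : IsOpen Ω) (hp : IsVariableExponent Ω p)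
    (hK : IsKernel s Ω p K) {u : Eucl N → ℝ} (hu0 : ∀ᵐ x, x ∉ Ω → u x = 0)
    (hu : MemWK Ω p K u) : ∫⁻ z, ENNReal.ofReal (gagliardoDensity p K u z) < ⊤ := by
  obtain ⟨P, hP1, hP⟩ := hp.exists_le
  obtain ⟨-, a, ha, hfin⟩ := hu
  rw [lintegral_gagliardoDensity_eq hΩo hp hu0]
  calc gagliardoModular Ω p K u 1
      ≤ ∫⁻ z in Q Ω, ENNReal.ofReal (max 1 a ^ P) * ENNReal.ofReal
          (|u z.1 - u z.2| ^ p z.1 z.2 / a ^ p z.1 z.2 * K z.1 z.2) := by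
        refine lintegral_mono fun z => ?_
        have hKz := hK.pos z.1 z.2
        rw [← ENNReal.ofReal_mul (by positivity), Real.one_rpow, div_one]
        refine ENNReal.ofReal_le_ofReal ?_
        have h1 : a ^ p z.1 z.2 ≤ max 1 a ^ P :=
          (Real.rpow_le_rpow ha.le (le_max_right _ _)
            (zero_lt_one.trans (hp.one_lt _ _)).le).trans
            (Real.rpow_le_rpow_of_exponent_le (le_max_left _ _) (hP _ _))
        have h2 : 0 < a ^ p z.1 z.2 := Real.rpow_pos_of_pos ha _
        calc |u z.1 - u z.2| ^ p z.1 z.2 * K z.1 z.2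
            = a ^ p z.1 z.2 * (|u z.1 - u z.2| ^ p z.1 z.2 / a ^ p z.1 z.2 * K z.1 z.2) := by
              field_simp
          _ ≤ _ := by gcongr
    _ = ENNReal.ofReal (max 1 a ^ P) * gagliardoModular Ω p K u a :=
        lintegral_const_mul' _ _ ENNReal.ofReal_ne_top
    _ < ⊤ := ENNReal.mul_lt_top ENNReal.ofReal_lt_top hfin

theorem lintegral_gagliardoDensity_inv_smul_le (hp : IsVariableExponent Ω p)
    (hK : IsKernel s Ω p K) {c : ℝ} (hc : 1 ≤ c) (u : Eucl N → ℝ) :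
    ∫⁻ z, ENNReal.ofReal (gagliardoDensity p K (c⁻¹ • u) z) ≤
      ENNReal.ofReal c⁻¹ * ∫⁻ z, ENNReal.ofReal (gagliardoDensity p K u z) := by
  rw [← lintegral_const_mul' _ _ ENNReal.ofReal_ne_top]
  have hc0 : 0 < c := zero_lt_one.trans_le hc
  refine lintegral_mono fun z => ?_
  rw [← ENNReal.ofReal_mul (by positivity)]
  refine ENNReal.ofReal_le_ofReal ?_
  have hKz := hK.pos z.1 z.2
  simp only [gagliardoDensity, Pi.smul_apply, smul_eq_mul]
  rw [← mul_sub, abs_mul, abs_of_pos (inv_pos.2 hc0),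
    Real.mul_rpow (by positivity) (abs_nonneg _), mul_assoc]
  have h : c⁻¹ ^ p z.1 z.2 ≤ c⁻¹ := by
    have := Real.rpow_le_rpow_of_exponent_ge (inv_pos.2 hc0) (inv_le_one_of_one_le₀ hc)
      (hp.one_lt z.1 z.2).le
    rwa [Real.rpow_one] at this
  gcongr

/-- Dividing by a large constant brings the modular below `1`, where the Poincaré inequality
applies. Hence the integrability of `|u| ^ p(x,x)` is automatic, and limits produced by Fatou's
lemma need only a finite Gagliardo modular to belong to the space. -/
theorem memWK_of_lintegral_lt_top (hs0 : 0 < s) (hs1 : s < 1) (hN : 0 < N)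
    (hΩo : IsOpen Ω) (hΩb : Bornology.IsBounded Ω) (hp : IsVariableExponent Ω p)
    (hK : IsKernel s Ω p K) {u : Eucl N → ℝ} (hu : Measurable u)
    (hu0 : ∀ᵐ x, x ∉ Ω → u x = 0)
    (hfin : ∫⁻ z, ENNReal.ofReal (gagliardoDensity p K u z) < ⊤) : MemWK Ω p K u := by
  obtain ⟨C, hC, hCu⟩ := exists_lebesgueModular_le hs0 hs1 hN hΩo hΩb hp hK
  set A := (∫⁻ z, ENNReal.ofReal (gagliardoDensity p K u z)).toReal with hA
  have hA0 : 0 ≤ A := ENNReal.toReal_nonneg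
  set c : ℝ := 1 + A with hc
  have hc1 : 1 ≤ c := by linarith
  have hc0 : 0 < c := by linarith
  have hv0 : ∀ᵐ x, x ∉ Ω → (c⁻¹ • u) x = 0 := by
    filter_upwards [hu0] with x hx hxΩ
    rw [Pi.smul_apply, hx hxΩ, smul_zero]
  have hle : ∫⁻ z, ENNReal.ofReal (gagliardoDensity p K (c⁻¹ • u) z) ≤ 1 := by
    refine (lintegral_gagliardoDensity_inv_smul_le hp hK hc1 u).trans ?_
    rw [← ENNReal.ofReal_toReal hfin.ne, ← hA, ← ENNReal.ofReal_mul (by positivity),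
      ← ENNReal.ofReal_one]
    refine ENNReal.ofReal_le_ofReal ?_
    rw [inv_mul_le_iff₀ hc0]
    linarith
  have hmem : MemWK Ω p K (c⁻¹ • u) := by
    refine ⟨(hCu _ (hu.const_smul _) hv0 hle).trans_lt ENNReal.ofReal_lt_top, 1, one_pos, ?_⟩
    rw [← lintegral_gagliardoDensity_eq hΩo hp hv0]
    exact hle.trans_lt ENNReal.one_lt_top
  have := MemWK.smul hp c hmem
  rwa [smul_smul, mul_inv_cancel₀ hc0.ne', one_smul] at this

/-- The measure `K(x,y) dx dy`. -/
noncomputable def kernelMeasure (K : Eucl N → Eucl N → ℝ) : Measure (Eucl N × Eucl N) :=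
  volume.withDensity fun z => ENNReal.ofReal (K z.1 z.2)

theorem kernelMeasure_absolutelyContinuous :
    kernelMeasure K ≪ (volume : Measure (Eucl N × Eucl N)) :=
  withDensity_absolutelyContinuous _ _

theorem integrable_kernelMeasure_iff (hK : IsKernel s Ω p K) {g : Eucl N × Eucl N → ℝ} :
    Integrable g (kernelMeasure K) ↔ Integrable (fun z => g z * K z.1 z.2) volume := by
  rw [kernelMeasure, integrable_withDensity_iff_integrable_smul'
    hK.measurable.ennreal_ofReal (Eventually.of_forall fun _ => ENNReal.ofReal_lt_top)]
  simp only [ENNReal.toReal_ofReal (hK.pos _ _).le, smul_eq_mul, mul_comm]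

theorem integral_kernelMeasure (hK : IsKernel s Ω p K) (g : Eucl N × Eucl N → ℝ) :
    ∫ z, g z ∂kernelMeasure K = ∫ z, g z * K z.1 z.2 := by
  rw [kernelMeasure, integral_withDensity_eq_integral_toReal_smul
    hK.measurable.ennreal_ofReal (Eventually.of_forall fun _ => ENNReal.ofReal_lt_top)]
  simp only [ENNReal.toReal_ofReal (hK.pos _ _).le, smul_eq_mul, mul_comm]

theorem ae_kernelMeasure_of_ae {R : Eucl N → Prop} (h : ∀ᵐ x, R x) :
    ∀ᵐ z ∂kernelMeasure K, R z.1 ∧ R z.2 := by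
  have h1 : ∀ᵐ z : Eucl N × Eucl N, R z.1 := Measure.quasiMeasurePreserving_fst.ae h
  have h2 : ∀ᵐ z : Eucl N × Eucl N, R z.2 := Measure.quasiMeasurePreserving_snd.ae h
  exact kernelMeasure_absolutelyContinuous.ae_le (h1.and h2)

variable {hp : IsVariableExponent Ω p} {hKm : Measurable fun z : Eucl N × Eucl N => K z.1 z.2}

/-- `u(x) - u(y)` at `z = (x, y)`. -/
noncomputable def increment (u : WK0 hp hKm) (z : Eucl N × Eucl N) : ℝ :=
  (u : Eucl N →ₘ[volume] ℝ) z.1 - (u : Eucl N →ₘ[volume] ℝ) z.2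

theorem isModularMap_increment (hΩo : IsOpen Ω) (hK : IsKernel s Ω p K) {P : ℝ}
    (hP : ∀ x y, p x y ≤ P) :
    IsModularMap (kernelMeasure K) (fun z => p z.1 z.2)
      (⨅ z : Eucl N × Eucl N, p z.1 z.2) P (increment (hp := hp) (hKm := hKm)) where
  measurable_exponent := hp.continuous.measurable
  one_lt := hp.one_lt_iInf
  le_exponent z := ciInf_le (f := fun z : Eucl N × Eucl N => p z.1 z.2)
    ⟨1, by rintro _ ⟨z, rfl⟩; exact (hp.one_lt _ _).le⟩ z
  exponent_le z := hP z.1 z.2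
  measurable u := by
    have := (u : Eucl N →ₘ[volume] ℝ).measurable
    unfold increment
    fun_prop
  add u v := by
    filter_upwards [ae_kernelMeasure_of_ae (AEEqFun.coeFn_add
      (u : Eucl N →ₘ[volume] ℝ) (v : Eucl N →ₘ[volume] ℝ))] with z hz
    simp only [increment, Submodule.coe_add, hz.1, hz.2, Pi.add_apply]
    ring
  smul c u := by
    filter_upwards [ae_kernelMeasure_of_ae (AEEqFun.coeFn_smul c
      (u : Eucl N →ₘ[volume] ℝ))] with z hz
    simp only [increment, Submodule.coe_smul, hz.1, hz.2, Pi.smul_apply, smul_eq_mul]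
    ring
  integrable u := by
    rw [integrable_kernelMeasure_iff hK]
    have hm := measurable_gagliardoDensity hp hK (u : Eucl N →ₘ[volume] ℝ).measurable
    exact (lintegral_ofReal_ne_top_iff_integrable hm.aestronglyMeasurable
      (Eventually.of_forall (gagliardoDensity_nonneg hK _))).1
      (lintegral_gagliardoDensity_lt_top hΩo hp hK u.2.2 u.2.1).ne

theorem lintegral_gagliardoDensity_eq_ofReal (hΩo : IsOpen Ω) (hK : IsKernel s Ω p K)
    (u : WK0 hp hKm) :
    ∫⁻ z, ENNReal.ofReal (gagliardoDensity p K (u : Eucl N →ₘ[volume] ℝ) z) =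
      ENNReal.ofReal (IsModularMap.modular (kernelMeasure K) (fun z => p z.1 z.2)
        increment u) := by
  obtain ⟨P, -, hP⟩ := hp.exists_le
  have hi := (integrable_kernelMeasure_iff hK).1
    ((isModularMap_increment (hp := hp) (hKm := hKm) hΩo hK hP).integrable u)
  rw [IsModularMap.modular, integral_kernelMeasure hK,
    ofReal_integral_eq_lintegral_ofReal hi
      (Eventually.of_forall (gagliardoDensity_nonneg hK _))]
  rfl

/-- Multiplying `w` by `c` raises the modular by at most `c ^ P`, so the `L¹` bound applies to `c •
w`. As `c → ∞`, modular convergence to zero implies `L¹` convergence to zero. -/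
theorem exists_lintegral_abs_le_of_modular_le (hs0 : 0 < s) (hs1 : s < 1) (hN : 0 < N)
    (hΩo : IsOpen Ω) (hΩb : Bornology.IsBounded Ω) (hK : IsKernel s Ω p K) {P : ℝ}
    (hP : ∀ x y, p x y ≤ P) :
    ∃ C : ℝ, 0 ≤ C ∧ ∀ c : ℝ, 1 ≤ c → ∀ w : WK0 hp hKm,
      IsModularMap.modular (kernelMeasure K) (fun z => p z.1 z.2) increment w ≤ (c ^ P)⁻¹ →
      ∫⁻ x, ENNReal.ofReal |(w : Eucl N →ₘ[volume] ℝ) x| ≤ ENNReal.ofReal (C / c) := by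
  obtain ⟨C, hC, hCu⟩ := exists_lintegral_abs_le hs0 hs1 hN hΩb hp hK
  refine ⟨C, hC, fun c hc w hw => ?_⟩
  have hc0 : 0 < c := by linarith
  have hcP : 0 < c ^ P := Real.rpow_pos_of_pos hc0 P
  have H := isModularMap_increment (hp := hp) (hKm := hKm) hΩo hK hP
  have h1 : IsModularMap.modular (kernelMeasure K) (fun z => p z.1 z.2) increment (c • w) ≤ 1 := by
    refine (H.modular_smul_le hc w).trans ?_
    calc c ^ P * _ ≤ c ^ P * (c ^ P)⁻¹ := by gcongr
      _ = 1 := mul_inv_cancel₀ hcP.ne'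
  have h2 := hCu _ ((c • w : WK0 hp hKm) : Eucl N →ₘ[volume] ℝ).measurable (c • w).2.2 (by
    rw [lintegral_gagliardoDensity_eq_ofReal hΩo hK, ← ENNReal.ofReal_one]
    exact ENNReal.ofReal_le_ofReal h1)
  have h3 : ∫⁻ x, ENNReal.ofReal |((c • w : WK0 hp hKm) : Eucl N →ₘ[volume] ℝ) x| =
      ENNReal.ofReal c * ∫⁻ x, ENNReal.ofReal |(w : Eucl N →ₘ[volume] ℝ) x| := by
    rw [← lintegral_const_mul' _ _ ENNReal.ofReal_ne_top]
    refine lintegral_congr_ae ?_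
    filter_upwards [AEEqFun.coeFn_smul c (w : Eucl N →ₘ[volume] ℝ)] with x hx
    rw [Submodule.coe_smul, hx, Pi.smul_apply, smul_eq_mul, abs_mul, abs_of_pos hc0,
      ENNReal.ofReal_mul hc0.le]
  rw [h3, mul_comm] at h2
  rw [ENNReal.ofReal_div_of_pos hc0, ENNReal.le_div_iff_mul_le
    (Or.inl (ENNReal.ofReal_pos.2 hc0).ne') (Or.inl ENNReal.ofReal_ne_top)]
  exact h2

theorem eq_zero_of_increment_ae_eq_zero (hs0 : 0 < s) (hs1 : s < 1) (hN : 0 < N)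
    (hΩo : IsOpen Ω) (hΩb : Bornology.IsBounded Ω) (hK : IsKernel s Ω p K)
    (u : WK0 hp hKm) (hu : increment u =ᵐ[kernelMeasure K] 0) : u = 0 := by
  obtain ⟨P, -, hP⟩ := hp.exists_le
  obtain ⟨C, hC, hCu⟩ := exists_lintegral_abs_le_of_modular_le (hp := hp) (hKm := hKm)
    hs0 hs1 hN hΩo hΩb hK hP
  have hmod : IsModularMap.modular (kernelMeasure K) (fun z => p z.1 z.2) increment u = 0 := by
    rw [IsModularMap.modular, integral_congr_ae (g := fun _ => 0)]
    · simp
    · filter_upwards [hu] with z hz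
      rw [hz, Pi.zero_apply, abs_zero,
        Real.zero_rpow (zero_lt_one.trans (hp.one_lt _ _)).ne']
  have hlim : Tendsto (fun c : ℝ => ENNReal.ofReal (C / c)) atTop (𝓝 0) := by
    have := ENNReal.tendsto_ofReal (tendsto_const_nhds.div_atTop tendsto_id (a := C))
    rwa [ENNReal.ofReal_zero] at this
  have h0 : ∫⁻ x, ENNReal.ofReal |(u : Eucl N →ₘ[volume] ℝ) x| = 0 := by
    refine le_antisymm (ge_of_tendsto hlim ?_) zero_le
    filter_upwards [eventually_ge_atTop 1] with c hc
    refine hCu c hc u ?_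
    rw [hmod]
    positivity
  have hm := (u : Eucl N →ₘ[volume] ℝ).measurable
  rw [lintegral_eq_zero_iff (by fun_prop)] at h0
  refine Subtype.ext (AEEqFun.ext ?_)
  filter_upwards [h0, AEEqFun.coeFn_zero (α := Eucl N) (μ := volume) (β := ℝ)] with x hx h1
  rw [ZeroMemClass.coe_zero, h1]
  simpa using hx

/-- Sequences that are Cauchy for the modular converge almost everywhere along a subsequence. -/
theorem exists_increment_ae_tendsto (hs0 : 0 < s) (hs1 : s < 1) (hN : 0 < N)
    (hΩo : IsOpen Ω) (hΩb : Bornology.IsBounded Ω) (hK : IsKernel s Ω p K)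
    (u : ℕ → WK0 hp hKm)
    (hu : ∀ ε > 0, ∃ n₀, ∀ k ≥ n₀, ∀ l ≥ n₀,
      IsModularMap.modular (kernelMeasure K) (fun z => p z.1 z.2) increment (u k - u l) ≤ ε) :
    ∃ w : WK0 hp hKm, ∃ ns : ℕ → ℕ, StrictMono ns ∧
      ∀ᵐ z ∂kernelMeasure K,
        Tendsto (fun k => increment (u (ns k)) z) atTop (𝓝 (increment w z)) := by
  obtain ⟨P, hP1, hP⟩ := hp.exists_le
  have H := isModularMap_increment (hp := hp) (hKm := hKm) hΩo hK hP
  obtain ⟨C, hC, hCu⟩ := exists_lintegral_abs_le_of_modular_le (hp := hp) (hKm := hKm)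
    hs0 hs1 hN hΩo hΩb hK hP
  -- A geometric `L¹` rate along the subsequence is summable and forces convergence a.e. on `ℝ^N`.
  have hsub : ∀ n : ℕ, ∃ n₀, ∀ k ≥ n₀, ∀ i ≥ k, ∀ j ≥ k,
      ∫⁻ x, ENNReal.ofReal |((u i - u j : WK0 hp hKm) : Eucl N →ₘ[volume] ℝ) x| <
        (1 / 2 : ENNReal) ^ n := by
    intro n
    have hlim : Tendsto (fun c : ℝ => ENNReal.ofReal (C / c)) atTop (𝓝 0) := by
      have := ENNReal.tendsto_ofReal (tendsto_const_nhds.div_atTop tendsto_id (a := C))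
      rwa [ENNReal.ofReal_zero] at this
    have hpos : (0 : ENNReal) < (1 / 2 : ENNReal) ^ n :=
      ENNReal.pow_pos (by simp) n
    obtain ⟨c, hc, hc1⟩ := ((hlim.eventually (gt_mem_nhds hpos)).and
      (eventually_ge_atTop 1)).exists
    obtain ⟨n₀, hn₀⟩ := hu (c ^ P)⁻¹ (by positivity)
    exact ⟨n₀, fun k hk i hi j hj =>
      (hCu c hc1 _ (hn₀ i (hk.trans hi) j (hk.trans hj))).trans_lt hc⟩
  obtain ⟨ns, hns, hnsu⟩ := extraction_forall_of_eventually' hsub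
  have hconv : ∀ᵐ x, ∃ l, Tendsto (fun k => (u (ns k) : Eucl N →ₘ[volume] ℝ) x) atTop (𝓝 l) := by
    refine Lp.ae_tendsto_of_cauchy_eLpNorm (p := 1) (B := fun n => (1 / 2 : ENNReal) ^ n)
      (fun n => (u (ns n) : Eucl N →ₘ[volume] ℝ).aestronglyMeasurable) le_rfl ?_ ?_
    · rw [ENNReal.tsum_geometric]
      simp
    · intro n i j hi hj
      refine lt_of_eq_of_lt ?_ (hnsu n (ns i) (hns.monotone hi) (ns j) (hns.monotone hj))
      rw [eLpNorm_one_eq_lintegral_enorm]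
      refine lintegral_congr_ae ?_
      filter_upwards [AEEqFun.coeFn_sub (u (ns i) : Eucl N →ₘ[volume] ℝ)
        (u (ns j) : Eucl N →ₘ[volume] ℝ)] with x hx
      rw [Submodule.coe_sub, hx, Real.enorm_eq_ofReal_abs]
  obtain ⟨v, hvm, hv⟩ := measurable_limit_of_tendsto_metrizable_ae
    (fun n => (u (ns n) : Eucl N →ₘ[volume] ℝ).measurable.aemeasurable) hconv
  -- The Cauchy condition bounds differences only, so Fatou's lemma is applied to `u (ns k) - u n₀`.
  -- The limit `v - b` lies in the space, and `u n₀` is added back at the end.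
  obtain ⟨n₀, hn₀⟩ := hu 1 one_pos
  set b : Eucl N → ℝ := ((u n₀ : Eucl N →ₘ[volume] ℝ) : Eucl N → ℝ) with hb
  have hv0 : ∀ᵐ x, x ∉ Ω → (v - b) x = 0 := by
    filter_upwards [hv, ae_all_iff.2 fun n => (u (ns n)).2.2, (u n₀).2.2] with x h1 h2 h3 hx
    have : v x = 0 := tendsto_nhds_unique h1 (by simp only [h2 _ hx, tendsto_const_nhds])
    rw [Pi.sub_apply, this, hb, h3 hx, sub_zero]
  have hvb : Measurable (v - b) := hvm.sub (u n₀ : Eucl N →ₘ[volume] ℝ).measurable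
  have hlim : ∀ᵐ z ∂kernelMeasure K,
      Tendsto (fun k => increment (u (ns k)) z) atTop (𝓝 (v z.1 - v z.2)) := by
    filter_upwards [ae_kernelMeasure_of_ae hv] with z hz
    exact hz.1.sub hz.2
  have hfat : Integrable (fun z : Eucl N × Eucl N =>
      |(v - b) z.1 - (v - b) z.2| ^ p z.1 z.2) (kernelMeasure K) := by
    refine (integrable_and_integral_le_of_ae_tendsto (M := 1)
      (g := fun k z => |increment (u (ns k) - u n₀) z| ^ p z.1 z.2)
      (fun k => H.measurable_rpow _) (fun k z => Real.rpow_nonneg (abs_nonneg _) _)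
      (fun k => H.integrable _) ?_ ?_).1
    · filter_upwards [eventually_ge_atTop n₀] with k hk
      exact hn₀ _ (hk.trans hns.le_apply) _ le_rfl
    · filter_upwards [hlim, ae_all_iff.2 fun k => H.sub (u (ns k)) (u n₀)] with z h1 h2
      simp only [h2]
      refine Tendsto.rpow_const (Tendsto.abs ?_)
        (Or.inr (zero_lt_one.trans (hp.one_lt _ _)).le)
      have e : (v - b) z.1 - (v - b) z.2 = (v z.1 - v z.2) - increment (u n₀) z := by
        simp only [Pi.sub_apply, increment, hb]
        ring
      rw [e]
      exact h1.sub_const _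
  have hmem : MemWK Ω p K (v - b) := by
    refine memWK_of_lintegral_lt_top hs0 hs1 hN hΩo hΩb hp hK hvb hv0 ?_
    exact lt_top_iff_ne_top.2 ((lintegral_ofReal_ne_top_iff_integrable
      (measurable_gagliardoDensity hp hK hvb).aestronglyMeasurable
      (Eventually.of_forall (gagliardoDensity_nonneg hK _))).2
      ((integrable_kernelMeasure_iff hK).1 hfat))
  set d : Eucl N →ₘ[volume] ℝ := AEEqFun.mk (v - b) hvb.aestronglyMeasurable with hd
  have hdv : d =ᵐ[volume] v - b := AEEqFun.coeFn_mk _ _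
  have hdW : d ∈ WK0 hp hKm := by
    refine ⟨hmem.congr hdv.symm, ?_⟩
    filter_upwards [hdv, hv0] with x h1 h2 hx
    rw [h1, h2 hx]
  refine ⟨⟨d, hdW⟩ + u n₀, ns, hns, ?_⟩
  filter_upwards [hlim, H.add ⟨d, hdW⟩ (u n₀), ae_kernelMeasure_of_ae hdv] with z h1 h2 h3
  rw [h2]
  convert h1 using 2
  simp only [increment, h3.1, h3.2, Pi.sub_apply, hb]
  ring

/-- A bounded linear functional is bounded on the unit ball of the modular. -/
theorem MemDual.exists_abs_le (hs0 : 0 < s) (hs1 : s < 1) (hN : 0 < N)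
    (hΩo : IsOpen Ω) (hΩb : Bornology.IsBounded Ω) (hK : IsKernel s Ω p K)
    {f : WK0 hp hKm →ₗ[ℝ] ℝ} (hf : MemDual f) :
    ∃ C : ℝ, ∀ φ : WK0 hp hKm,
      IsModularMap.modular (kernelMeasure K) (fun z => p z.1 z.2) increment φ ≤ 1 →
      |f φ| ≤ C := by
  obtain ⟨A, hA⟩ := hf
  obtain ⟨C, hC, hCu⟩ := exists_lebesgueModular_le hs0 hs1 hN hΩo hΩb hp hK
  refine ⟨|A| * (max 1 C + 1), fun φ hφ => (hA φ).trans ?_⟩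
  have hle : ∫⁻ z, ENNReal.ofReal (gagliardoDensity p K (φ : Eucl N →ₘ[volume] ℝ) z) ≤ 1 := by
    rw [lintegral_gagliardoDensity_eq_ofReal hΩo hK, ← ENNReal.ofReal_one]
    exact ENNReal.ofReal_le_ofReal hφ
  have hG : gagliardoSeminorm Ω p K (φ : Eucl N →ₘ[volume] ℝ) ≤ 1 := by
    refine csInf_le ⟨0, fun _ h => h.1.le⟩ ⟨one_pos, ?_⟩
    rwa [← lintegral_gagliardoDensity_eq hΩo hp φ.2.2]
  have hL : lebesgueNorm Ω p (φ : Eucl N →ₘ[volume] ℝ) ≤ max 1 C := by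
    -- Since `L ≥ 1` and `p > 1`, dividing `φ` by `L` multiplies the modular by at most `L⁻¹ ≤ 1 /
    -- C` when `C > 0`, which brings it below `1`.
    set L := max 1 C with hLdef
    have hL1 : 1 ≤ L := le_max_left _ _
    have hL0 : 0 < L := by linarith
    refine csInf_le ⟨0, fun _ h => h.1.le⟩ ⟨hL0, ?_⟩
    calc lebesgueModular Ω p (φ : Eucl N →ₘ[volume] ℝ) L
        ≤ ∫⁻ x in Ω, ENNReal.ofReal L⁻¹ *
            ENNReal.ofReal (|(φ : Eucl N →ₘ[volume] ℝ) x / 1| ^ p x x) := by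
          refine lintegral_mono fun x => ?_
          rw [← ENNReal.ofReal_mul (by positivity), div_one]
          refine ENNReal.ofReal_le_ofReal ?_
          rw [div_eq_inv_mul, abs_mul, abs_of_pos (inv_pos.2 hL0),
            Real.mul_rpow (by positivity) (abs_nonneg _)]
          have h : L⁻¹ ^ p x x ≤ L⁻¹ := by
            have := Real.rpow_le_rpow_of_exponent_ge (inv_pos.2 hL0)
              (inv_le_one_of_one_le₀ hL1) (hp.one_lt x x).le
            rwa [Real.rpow_one] at this
          gcongr
      _ = ENNReal.ofReal L⁻¹ * lebesgueModular Ω p (φ : Eucl N →ₘ[volume] ℝ) 1 :=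
          lintegral_const_mul' _ _ ENNReal.ofReal_ne_top
      _ ≤ ENNReal.ofReal L⁻¹ * ENNReal.ofReal C := by
          gcongr
          exact hCu _ (φ : Eucl N →ₘ[volume] ℝ).measurable φ.2.2 hle
      _ ≤ 1 := by
          rw [← ENNReal.ofReal_mul (by positivity), ← ENNReal.ofReal_one]
          refine ENNReal.ofReal_le_ofReal ?_
          rw [inv_mul_le_iff₀ hL0, mul_one]
          exact le_max_right _ _
  have h0 : 0 ≤ normK Ω p K (φ : Eucl N →ₘ[volume] ℝ) :=
    add_nonneg (Real.sInf_nonneg fun _ h => h.1.le) (Real.sInf_nonneg fun _ h => h.1.le)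
  calc A * normK Ω p K (φ : Eucl N →ₘ[volume] ℝ)
      ≤ |A| * normK Ω p K (φ : Eucl N →ₘ[volume] ℝ) :=
        mul_le_mul_of_nonneg_right (le_abs_self A) h0
    _ ≤ |A| * (max 1 C + 1) :=
        mul_le_mul_of_nonneg_left (add_le_add hL hG) (abs_nonneg A)

end Solvability

end NonlocalDirichlet

theorem theorem5p2 (N : ℕ) (s : ℝ) (hs0 : 0 < s) (hs1 : s < 1)
    (Ω : Set (NonlocalDirichlet.Eucl N)) (hΩo : IsOpen Ω) (hΩb : Bornology.IsBounded Ω)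
    (p K : NonlocalDirichlet.Eucl N → NonlocalDirichlet.Eucl N → ℝ)
    (hp : NonlocalDirichlet.IsVariableExponent Ω p)
    (hsp : s * NonlocalDirichlet.pPlus Ω p < N)
    (hK : NonlocalDirichlet.IsKernel s Ω p K)
    (f : NonlocalDirichlet.WK0 hp hK.measurable →ₗ[ℝ] ℝ)
    (hf : NonlocalDirichlet.MemDual f) :
    ∃! u : NonlocalDirichlet.WK0 hp hK.measurable, NonlocalDirichlet.IsWeakSolution f u := by
  have hN := NonlocalDirichlet.dimension_pos hs0 hp hsp
  obtain ⟨P, -, hP⟩ := hp.exists_le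
  obtain ⟨C, hC⟩ := hf.exists_abs_le hs0 hs1 hN hΩo hΩb hK
  have H := (NonlocalDirichlet.isModularMap_increment (hp := hp) (hKm := hK.measurable)
    hΩo hK hP).existsUnique_integral_eq
    (NonlocalDirichlet.eq_zero_of_increment_ae_eq_zero hs0 hs1 hN hΩo hΩb hK)
    (NonlocalDirichlet.exists_increment_ae_tendsto hs0 hs1 hN hΩo hΩb hK) hC
  -- Once the density `K` is moved from the measure into the integrand, the integrand is
  -- `weakIntegrand` by definition.
  simp only [NonlocalDirichlet.integrable_kernelMeasure_iff hK,
    NonlocalDirichlet.integral_kernelMeasure hK] at H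
  exact H
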